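/- Let $r\ge 1$, let $\mathbb I=\{0,1,\dots,2r\}$ be the node set of the affine Dynkin diagram $A^{(1)}_{2r}$ (a cycle) with Cartan matrix $(c_{ij})$, and let $\tau$ be the diagram involution with $\tau(0)=0$ and $\tau(i)=2r+1-i$ for $1\le i\le 2r$. Let $W=\langle s_i\mid i\in\mathbb I\rangle$ be the affine Weyl group inside the extended affine Weyl group $\widetilde W=W_0\ltimes P$ of type $A_{2r}$, both regarded as acting faithfully on the affine root lattice by $s_i(\alpha_j)=\alpha_j-c_{ij}\alpha_i$ and $t_\omega(\alpha_j)=\alpha_j-\langle\omega,\alpha_j\rangle\delta$ $(\omega\in P)$. Let $W_\tau=\{w\in W\mid \tau w=w\tau\}$ be the relative affine Weyl group, with generators $\mathbf r_0,\dots,\mathbf r_r$, where $\mathbf r_0=s_0$, $\mathbf r_i=s_is_{\tau i}$ for $1\le i<r$, and $\mathbf r_r=s_rs_{r+1}s_r$. Let $\mathrm{Br}(W_\tau)=\langle t_0,\dots,t_r\rangle$ be the associated braid group (the ibraid group), defined by the braid relations of the $\mathbf r_i$: $t_it_jt_i\cdots=t_jt_it_j\cdots$ with $m_{ij}$ factors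 on each side, where $m_{ij}$ is the order of $\mathbf r_i\mathbf r_j$ (no relation if $m_{ij}=\infty$). For $1\le k\le r$ put $\varpi_k=t_{\omega_k}t_{\omega_{\tau k}}$, where $\omega_i$ are the fundamental weights. For elements $T_0,\dots,T_r$ of a group that satisfy these braid relations and $w\in W_\tau$, write $T_w=T_{i_1}\cdots T_{i_m}$ for any reduced expression $w=\mathbf r_{i_1}\cdots \mathbf r_{i_m}$ (shortest in the generators $\mathbf r_0,\dots,\mathbf r_r$); this does not depend on the reduced expression. Then for $1\le k\le r$ one has $\varpi_k\in W_\tau$ and, in $\mathrm{Br}(W_\tau)$ with $T_i=t_i$, $$T_{\varpi_k}=(T_0T_1\cdots T_{r-1}T_rT_{r-1}\cdots T_k)^k .$$ In particular $$T_{\varpi_1}=T_0T_1\cdots T_{r-1}T_rT_{r-1}\cdots T_1,\qquad T_{\varpi_r}=(T_0T_1\cdots T_r)^r,$$ and, if $r\ge 2$, also $$T_{\varpi_{r-1}}=(T_0T_1\cdots T_r)^{r-1}\,T_1T_2\cdots T_{r-1}.$$ (For $k=r$ the decreasing part $T_{r-1}\cdots T_k$ is empty.) The same identities hold for the automorphisms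 $T_i=\mathbf T_i$ of the universal affine iquantum group $\widetilde{\mathbf U}^\imath$ of type $\mathrm{AIII}_{2r}^{(\tau)}$ over $\mathbb Q(v)$, by which $\mathrm{Br}(W_\tau)$ acts on it via $t_i\mapsto\mathbf T_i$. -/

import Mathlib

noncomputable section

namespace IBraid

/-! ## The affine Dynkin diagram with involution -/

/-- The set `𝕀 = {0, 1, …, 2r}` of nodes of the affine Dynkin diagram `A_{2r}^{(1)}`
(a cycle of length `2r + 1`), with its cyclic structure. -/
abbrev Node (r : ℕ) : Type := ZMod (2 * r + 1)

/-- The Cartan matrix `(c_{ij})` of affine type `A_{2r}^{(1)}`, `r ≥ 1`. -/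
def cartan (r : ℕ) (i j : Node r) : ℤ :=
  if i = j then 2 else if i = j + 1 ∨ j = i + 1 then -1 else 0

/-- The diagram involution `τ`: it fixes `0` and sends `i` to `2r + 1 - i` for `1 ≤ i ≤ 2r`. -/
def tau (r : ℕ) (i : Node r) : Node r := -i

/-! ## The affine Weyl group, translations, and the relative affine Weyl group

The extended affine Weyl group `W₀ ⋉ P` acts faithfully on the affine root lattice `ℤ𝕀` by
`s_i(α_j) = α_j - c_{ij} α_i` and `t_ω(α_j) = α_j - ⟨ω, α_j⟩ δ`; its elements are
represented below by the corresponding automorphisms of `ℤ𝕀`. -/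

/-- The affine root lattice `ℤ𝕀`; the simple root `α_i` is `Pi.single i 1`. -/
abbrev RootLattice (r : ℕ) : Type := Node r → ℤ

/-- The simple root `α_i`. -/
def simpleRoot (r : ℕ) (i : Node r) : RootLattice r := Pi.single i 1

/-- The basic imaginary root `δ = α_0 + α_1 + ⋯ + α_{2r}`. -/
def delta (r : ℕ) : RootLattice r := ∑ i, simpleRoot r i

theorem delta_apply (r : ℕ) (j : Node r) : delta r j = 1 := by
  simp [delta, simpleRoot, Finset.sum_apply, Pi.single_apply]

/-- The functional `α_j ↦ c_{ij}` on the root lattice. -/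
def simpleCoroot (r : ℕ) (i : Node r) : Module.Dual ℤ (RootLattice r) :=
  ∑ j, cartan r i j • LinearMap.proj j

theorem simpleCoroot_simpleRoot (r : ℕ) (i j : Node r) :
    simpleCoroot r i (simpleRoot r j) = cartan r i j := by
  simp [simpleCoroot, simpleRoot, Pi.single_apply]

/-- The simple reflection `s_i`, `α_j ↦ α_j - c_{ij} α_i`. -/
def simpleReflection (r : ℕ) (i : Node r) : RootLattice r ≃ₗ[ℤ] RootLattice r :=
  Module.reflection (x := simpleRoot r i) (f := simpleCoroot r i)
    (by rw [simpleCoroot_simpleRoot]; simp [cartan])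

theorem simpleReflection_apply (r : ℕ) (i : Node r) (x : RootLattice r) :
    simpleReflection r i x = x - simpleCoroot r i x • simpleRoot r i := by
  simp [simpleReflection, Module.reflection_apply]

/-- The affine Weyl group `W = ⟨s_i ∣ i ∈ 𝕀⟩`. -/
def affineWeylGroup (r : ℕ) : Subgroup (RootLattice r ≃ₗ[ℤ] RootLattice r) :=
  Subgroup.closure (Set.range (simpleReflection r))

/-- The automorphism of the root lattice induced by the diagram involution: `α_i ↦ α_{τ i}`. -/
def tauLattice (r : ℕ) : RootLattice r ≃ₗ[ℤ] RootLattice r :=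
  LinearEquiv.funCongrLeft ℤ ℤ (Equiv.neg (Node r))

/-- The relative affine Weyl group `W_τ = {w ∈ W ∣ τ w = w τ}`. -/
def relativeWeylGroup (r : ℕ) : Subgroup (RootLattice r ≃ₗ[ℤ] RootLattice r) :=
  affineWeylGroup r ⊓ Subgroup.centralizer {tauLattice r}

/-- The weight lattice `P` of the simple Lie algebra of type `A_{2r}`: a weight `ω` is given by
its pairings `⟨ω, α_j⟩` with the simple roots, subject to `⟨ω, δ⟩ = 0` (so that the values at
`α_1, …, α_{2r}` are arbitrary integers and determine the value at `α_0 = δ - θ`). -/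
def weightLattice (r : ℕ) : Submodule ℤ (Module.Dual ℤ (RootLattice r)) :=
  LinearMap.ker (Module.Dual.eval ℤ (RootLattice r) (delta r))

/-- The functional reading off the coefficient of `α_i`. -/
def coordinate (r : ℕ) (i : Node r) : Module.Dual ℤ (RootLattice r) := LinearMap.proj i

theorem coordinate_apply (r : ℕ) (i : Node r) (x : RootLattice r) : coordinate r i x = x i := rfl

/-- The fundamental weight `ω_i`, for `i ∈ 𝕀₀ = 𝕀 ∖ {0}`: `⟨ω_i, α_j⟩` is `1` if `j = i` and `0` if
`j ∈ 𝕀₀ ∖ {i}`.  (For `i = 0` this formula gives `0`.) -/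
def fundamentalWeight (r : ℕ) (i : Node r) : weightLattice r :=
  ⟨coordinate r i - coordinate r 0, by
    rw [weightLattice, LinearMap.mem_ker, Module.Dual.eval_apply, LinearMap.sub_apply,
      coordinate_apply, coordinate_apply, delta_apply, delta_apply, sub_self]⟩

/-- The translation `t_ω`, `ω ∈ P`, acting by `β ↦ β - ⟨ω, β⟩ δ`. -/
def translation (r : ℕ) (ω : weightLattice r) : RootLattice r ≃ₗ[ℤ] RootLattice r :=
  LinearEquiv.transvection (f := -ω.1) (v := delta r) (by
    have h : ω.1 (delta r) = 0 := ω.2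
    simp [h])

theorem translation_apply (r : ℕ) (ω : weightLattice r) (x : RootLattice r) :
    translation r ω x = x - ω.1 x • delta r := by
  simp [translation, LinearMap.transvection.apply, sub_eq_add_neg]

/-- The element `ϖ_i = t_{ω_i} t_{ω_{τ i}}` of the extended affine Weyl group, `i ∈ 𝕀₀`. -/
def varpi (r : ℕ) (i : Node r) : RootLattice r ≃ₗ[ℤ] RootLattice r :=
  translation r (fundamentalWeight r i) * translation r (fundamentalWeight r (tau r i))

/-- The representative in `𝕀` of the `τ`-orbit with index `i ∈ 𝕀_τ = {0, 1, …, r}`. -/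
def rep (r : ℕ) (i : Fin (r + 1)) : Node r := ((i : ℕ) : Node r)

/-- The generators `𝐫_i` of `W_τ`, for `i ∈ 𝕀`: `s_i` if `c_{i,τi} = 2`, `s_i s_{τi}` if
`c_{i,τi} = 0`, and `s_i s_{τi} s_i` if `c_{i,τi} = -1`. -/
def relReflection (r : ℕ) (i : Node r) : RootLattice r ≃ₗ[ℤ] RootLattice r :=
  if cartan r i (tau r i) = 2 then simpleReflection r i
  else if cartan r i (tau r i) = 0 then simpleReflection r i * simpleReflection r (tau r i)
  else simpleReflection r i * simpleReflection r (tau r i) * simpleReflection r i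

/-- The word `l = (i_1, …, i_m)` in `𝕀_τ` is a reduced expression of `w`: one has
`w = 𝐫_{i_1} ⋯ 𝐫_{i_m}`, and no shorter word does this. -/
def IsReducedExpr (r : ℕ) (l : List (Fin (r + 1))) (w : RootLattice r ≃ₗ[ℤ] RootLattice r) :
    Prop :=
  (l.map fun i => relReflection r (rep r i)).prod = w ∧
    ∀ l' : List (Fin (r + 1)),
      (l'.map fun i => relReflection r (rep r i)).prod = w → l.length ≤ l'.length

/-! ## The ibraid group -/

/-- The alternating product `a b a ⋯` with `m` factors. -/
def altProd {G : Type*} [Monoid G] (a b : G) : ℕ → G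
  | 0 => 1
  | m + 1 => a * altProd b a m

/-- The braid relations `t_i t_j t_i ⋯ = t_j t_i t_j ⋯` (`m` factors on each side), where `m` is
the order of `𝐫_i 𝐫_j` in `W_τ`.  (If that order is infinite, `orderOf` is `0` and the
relation is void.) -/
def braidRelations (r : ℕ) : Set (FreeGroup (Fin (r + 1))) :=
  {x | ∃ i j : Fin (r + 1), ∃ m : ℕ,
    m = orderOf (relReflection r (rep r i) * relReflection r (rep r j)) ∧
    x = altProd (FreeGroup.of i) (FreeGroup.of j) m *
      (altProd (FreeGroup.of j) (FreeGroup.of i) m)⁻¹}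

/-- The ibraid group `Br(W_τ)`: the braid group of the relative affine Weyl group. -/
abbrev IBraidGroup (r : ℕ) : Type := PresentedGroup (braidRelations r)

/-- The generator `t_i` of the ibraid group, `i ∈ 𝕀_τ = {0, …, r}`. -/
def braidGen (r : ℕ) (i : Fin (r + 1)) : IBraidGroup r := PresentedGroup.of i

/-- `g` is the element `T_w` attached to `w` by the family `T_0, …, T_r`: the element `w` has a
reduced expression, and `g = T_{i_1} ⋯ T_{i_m}` for every reduced expression
`w = 𝐫_{i_1} ⋯ 𝐫_{i_m}`. -/
def IsLift (r : ℕ) {G : Type*} [Group G] (T : Fin (r + 1) → G)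
    (w : RootLattice r ≃ₗ[ℤ] RootLattice r) (g : G) : Prop :=
  (∃ l, IsReducedExpr r l w) ∧ ∀ l, IsReducedExpr r l w → g = (l.map T).prod

/-- The increasing product `T_a T_{a+1} ⋯ T_b`; it is `1` if `b < a`. -/
def prodUp {r : ℕ} {G : Type*} [Group G] (T : Fin (r + 1) → G) (a b : ℕ) : G :=
  (((List.finRange (r + 1)).filter fun i : Fin (r + 1) => a ≤ (i : ℕ) ∧ (i : ℕ) ≤ b).map T).prod

/-- The decreasing product `T_a T_{a-1} ⋯ T_b`; it is `1` if `a < b`. -/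
def prodDown {r : ℕ} {G : Type*} [Group G] (T : Fin (r + 1) → G) (a b : ℕ) : G :=
  (((List.finRange (r + 1)).filter fun i : Fin (r + 1) => b ≤ (i : ℕ) ∧ (i : ℕ) ≤ a).reverse.map T).prod

/-! ## The universal affine iquantum group of type `AIII_{2r}^{(τ)}` -/

/-- The field `ℚ(v)`. -/
abbrev Scalar : Type := RatFunc ℚ

/-- The indeterminate `v`. -/
def v : Scalar := RatFunc.X

/-- Symbols for the generators `B_i`, `𝕂_i`, `𝕂_i⁻¹`, `i ∈ 𝕀`. -/
inductive Gen (r : ℕ) : Type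
  | B (i : Node r) : Gen r
  | K (i : Node r) : Gen r
  | Kinv (i : Node r) : Gen r

/-- The free algebra on the generators. -/
abbrev FreeAlg (r : ℕ) : Type := FreeAlgebra Scalar (Gen r)

/-- The generator `B_i` in the free algebra. -/
def fB {r : ℕ} (i : Node r) : FreeAlg r := FreeAlgebra.ι Scalar (Gen.B i)

/-- The generator `𝕂_i` in the free algebra. -/
def fK {r : ℕ} (i : Node r) : FreeAlg r := FreeAlgebra.ι Scalar (Gen.K i)

/-- The generator `𝕂_i⁻¹` in the free algebra. -/
def fKinv {r : ℕ} (i : Node r) : FreeAlg r := FreeAlgebra.ι Scalar (Gen.Kinv i)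

/-- The expression `x² y - [2] x y x + y x²`, where `[2] = v + v⁻¹`. -/
def serre {A : Type*} [Ring A] [Algebra Scalar A] (x y : A) : A :=
  x * x * y - (v + v⁻¹) • (x * y * x) + y * x * x

/-- The defining relations of the iquantum group. (Since all entries `c_{ij}`, `i ≠ j`, are `0` or
`-1`, the Serre relations for `j ≠ τ i ≠ i` amount to commutation, contained in `comm`, and to
`serre_tau_ne`.) -/
inductive Rel (r : ℕ) : FreeAlg r → FreeAlg r → Prop
  | K_Kinv (i : Node r) : Rel r (fK i * fKinv i) 1
  | Kinv_K (i : Node r) : Rel r (fKinv i * fK i) 1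
  | K_K (i l : Node r) : Rel r (fK i * fK l) (fK l * fK i)
  | K_B (l i : Node r) : Rel r (fK l * fB i)
      (v ^ (cartan r (tau r l) i - cartan r l i) • (fB i * fK l))
  | comm (i j : Node r) (h : cartan r i j = 0) (hτ : tau r i ≠ j) :
      Rel r (fB i * fB j) (fB j * fB i)
  | serre_tau_ne (i j : Node r) (h : cartan r i j = -1) (h₁ : j ≠ tau r i) (h₂ : tau r i ≠ i) :
      Rel r (serre (fB i) (fB j)) 0
  | comm_tau (i : Node r) (h : cartan r i (tau r i) = 0) :
      Rel r (fB (tau r i) * fB i - fB i * fB (tau r i))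
        ((v - v⁻¹)⁻¹ • (fK i - fK (tau r i)))
  | serre_fixed (i j : Node r) (h : cartan r i j = -1) (hτ : cartan r i (tau r i) = 2) :
      Rel r (serre (fB i) (fB j)) (-(v⁻¹ • (fB j * fK i)))
  | serre_tau (i : Node r) (h : cartan r i (tau r i) = -1) :
      Rel r (serre (fB i) (fB (tau r i)))
        (-((v + v⁻¹) • (v • (fK i * fB i) + v • (fB i * fK (tau r i)))))

/-- The universal affine iquantum group of type `AIII_{2r}^{(τ)}`, a `ℚ(v)`-algebra. -/
abbrev IQuantumGroup (r : ℕ) : Type := RingQuot (Rel r)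

/-- The generator `B_i` of the iquantum group. -/
def genB (r : ℕ) (i : Node r) : IQuantumGroup r := RingQuot.mkAlgHom Scalar (Rel r) (fB i)

/-- The invertible generator `𝕂_i` of the iquantum group. -/
def genK (r : ℕ) (i : Node r) : (IQuantumGroup r)ˣ where
  val := RingQuot.mkAlgHom Scalar (Rel r) (fK i)
  inv := RingQuot.mkAlgHom Scalar (Rel r) (fKinv i)
  val_inv := by
    rw [← map_mul, RingQuot.mkAlgHom_rel Scalar (Rel.K_Kinv i), map_one]
  inv_val := by
    rw [← map_mul, RingQuot.mkAlgHom_rel Scalar (Rel.Kinv_K i), map_one]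

/-- The commutator `[x, y]_a = x y - a y x`. -/
def qcomm {A : Type*} [Ring A] [Algebra Scalar A] (a : Scalar) (x y : A) : A :=
  x * y - a • (y * x)

/-- The element `𝐓_i(𝕂_j)` of the iquantum group. -/
def symK (r : ℕ) (i j : Node r) : IQuantumGroup r :=
  if cartan r i (tau r i) = 2 then
    ((genK r j * genK r i ^ (-cartan r i j) : (IQuantumGroup r)ˣ) : IQuantumGroup r)
  else if cartan r i (tau r i) = 0 then
    (-v) ^ (-cartan r i j - cartan r (tau r i) j) •
      ((genK r j * genK r i ^ (-cartan r i j) * genK r (tau r i) ^ (-cartan r (tau r i) j) :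
        (IQuantumGroup r)ˣ) : IQuantumGroup r)
  else
    v ^ (-(cartan r i j + cartan r (tau r i) j)) •
      ((genK r j * (genK r i * genK r (tau r i)) ^ (-cartan r i j - cartan r (tau r i) j) :
        (IQuantumGroup r)ˣ) : IQuantumGroup r)

/-- The element `𝐓_i(B_j)` of the iquantum group when `τ i = i`. -/
def symBfixed (r : ℕ) (i j : Node r) : IQuantumGroup r :=
  if j = i then ((genK r i)⁻¹ : (IQuantumGroup r)ˣ) * genB r i
  else if cartan r i j = -1 then qcomm v (genB r j) (genB r i)
  else genB r j

/-- The element `𝐓_i(B_j)` of the iquantum group when `c_{i,τi} = 0`. -/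
def symBzero (r : ℕ) (i j : Node r) : IQuantumGroup r :=
  if j = i then -(((genK r i)⁻¹ : (IQuantumGroup r)ˣ) * genB r (tau r i))
  else if j = tau r i then -(((genK r (tau r i))⁻¹ : (IQuantumGroup r)ˣ) * genB r i)
  else if cartan r i j = -1 ∧ cartan r (tau r i) j = 0 then
    qcomm v (genB r j) (genB r i)
  else if cartan r i j = 0 ∧ cartan r (tau r i) j = -1 then
    qcomm v (genB r j) (genB r (tau r i))
  else if cartan r i j = -1 ∧ cartan r (tau r i) j = -1 then
    qcomm v (qcomm v (genB r j) (genB r i)) (genB r (tau r i)) -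
      v • (genB r j * genK r i)
  else genB r j

/-- The element `𝐓_i(B_j)` of the iquantum group when `c_{i,τi} = -1`. -/
def symBneg (r : ℕ) (i j : Node r) : IQuantumGroup r :=
  if j = i then
    -(v ^ (-2 : ℤ) • (genB r i * ((genK r (tau r i))⁻¹ : (IQuantumGroup r)ˣ)))
  else if j = tau r i then
    -(v ^ (-2 : ℤ) • (genB r (tau r i) * ((genK r i)⁻¹ : (IQuantumGroup r)ˣ)))
  else if cartan r i j = -1 ∧ cartan r (tau r i) j = 0 then
    qcomm v (qcomm v (genB r j) (genB r i)) (genB r (tau r i)) - genK r i * genB r j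
  else if cartan r i j = 0 ∧ cartan r (tau r i) j = -1 then
    qcomm v (qcomm v (genB r j) (genB r (tau r i))) (genB r i) - genK r (tau r i) * genB r j
  else if cartan r i j = -1 ∧ cartan r (tau r i) j = -1 then
    v • qcomm 1 (qcomm 1 (qcomm v (genB r j) (genB r i)) (genB r (tau r i)))
        (qcomm v (genB r (tau r i)) (genB r i)) -
      qcomm 1 (genB r j) (qcomm (v ^ 3) (genB r (tau r i)) (genB r i)) * genK r i +
      v • (genB r j * genK r i * genK r (tau r i))
  else genB r j

/-- The element `𝐓_i(B_j)` of the iquantum group. -/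
def symB (r : ℕ) (i j : Node r) : IQuantumGroup r :=
  if cartan r i (tau r i) = 2 then symBfixed r i j
  else if cartan r i (tau r i) = 0 then symBzero r i j
  else symBneg r i j

/-- The homomorphism `Φ` is the ibraid group action on the iquantum group: `Φ(t_i)` is the
automorphism `𝐓_i` with the prescribed values on the generators, for `i ∈ 𝕀_τ`. -/
def IsIBraidAction (r : ℕ)
    (Φ : IBraidGroup r →* (IQuantumGroup r ≃ₐ[Scalar] IQuantumGroup r)) : Prop :=
  ∀ (i : Fin (r + 1)) (j : Node r),
    Φ (braidGen r i) (genB r j) = symB r (rep r i) j ∧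
    Φ (braidGen r i) (genK r j : IQuantumGroup r) = symK r (rep r i) j

end IBraid

end

/-!
The relative affine Weyl group `W_τ`, of affine type `C`, acts faithfully by the permutations of
`ℤ` that commute with `x ↦ x + (2r + 1)` and with `x ↦ 1 - x`: the generator `𝐫_i` exchanges `i`
with `i + 1`, except that `𝐫_r` exchanges `r` with `r + 2`, the fixed point `r + 1` being skipped.
A letter `i` increases the length of `w` exactly when `w` preserves the order of the two points
that `𝐫_i` exchanges. These sign conditions yield the exchange condition and hence Matsumoto's
theorem, so that it suffices to find one reduced expression for each element. The translation
`ϖ_k` corresponds to the permutation that moves `1, …, k` by one full period and fixes `k + 1, …,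
r`. The permutation of the word `0 1 ⋯ r ⋯ k` maps `1 ↦ 2 ↦ ⋯ ↦ k ↦ 1 + (2r + 1)` and fixes `k +
1, …, r`, so that its `k`-th power is `ϖ_k`, and every letter of the `k`-th power of this word
preserves the order of its two points, so the word is reduced. The second word for `ϖ_{r-1}` has
the same permutation and the same length as the first.
-/

namespace IBraid

/-! ### Matsumoto's theorem -/

section ReducedWords

variable {ι M : Type*} [Monoid M] {s : ι → M} {l l' : List ι}

/-- A word in the letters `s i` is reduced if no shorter word has the same product. -/
def IsReducedWord (s : ι → M) (l : List ι) : Prop :=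
  ∀ l' : List ι, (l'.map s).prod = (l.map s).prod → l.length ≤ l'.length

theorem IsReducedWord.of_length_le (hl : IsReducedWord s l)
    (e : (l'.map s).prod = (l.map s).prod) (h : l'.length ≤ l.length) : IsReducedWord s l' :=
  fun m hm => h.trans (hl m (hm.trans e))

theorem IsReducedWord.of_append_left (h : IsReducedWord s (l ++ l')) : IsReducedWord s l := by
  intro m hm
  have := h (m ++ l') (by simp [hm])
  simpa using this

theorem IsReducedWord.of_append_right (h : IsReducedWord s (l ++ l')) : IsReducedWord s l' := by
  intro m hm
  have := h (l ++ m) (by simp [hm])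
  simpa using this

theorem IsReducedWord.of_cons {i : ι} (h : IsReducedWord s (i :: l)) : IsReducedWord s l :=
  IsReducedWord.of_append_right (l := [i]) h

end ReducedWords

section Alternating

variable {ι M : Type*} [Monoid M]

/-- The alternating word `a b a ⋯` with `m` letters; its product is an `altProd`. -/
def altList (a b : ι) : ℕ → List ι
  | 0 => []
  | m + 1 => a :: altList b a m

theorem length_altList (a b : ι) (m : ℕ) : (altList a b m).length = m := by
  induction m generalizing a b with
  | zero => rfl
  | succ m ih => rw [altList, List.length_cons, ih]

theorem prod_map_altList (f : ι → M) (a b : ι) (m : ℕ) :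
    ((altList a b m).map f).prod = altProd (f a) (f b) m := by
  induction m generalizing a b with
  | zero => rfl
  | succ m ih => rw [altList, List.map_cons, List.prod_cons, ih, altProd]

theorem map_altProd {N : Type*} [Monoid N] (φ : M →* N) (a b : M) (m : ℕ) :
    φ (altProd a b m) = altProd (φ a) (φ b) m := by
  induction m generalizing a b with
  | zero => exact map_one φ
  | succ m ih => rw [altProd, map_mul, ih, altProd]

theorem exists_altProd_succ_eq (f : ι → M) (a b : ι) (m : ℕ) :
    ∃ c, altProd (f a) (f b) (m + 1) = altProd (f a) (f b) m * f c := by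
  induction m generalizing a b with
  | zero => exact ⟨a, by simp [altProd]⟩
  | succ m ih =>
    obtain ⟨c, hc⟩ := ih b a
    exact ⟨c, by rw [altProd, hc, ← mul_assoc, altProd]⟩

theorem altProd_eq_pow_mul {a b : M} (ha : a * a = 1) (hb : b * b = 1) (m : ℕ) :
    altProd a b m = (a * b) ^ m * altProd b a m := by
  induction m generalizing a b with
  | zero => simp [altProd]
  | succ m ih =>
    have shift : a * (b * a) ^ m = (a * b) ^ m * a :=
      SemiconjBy.pow_right (show a * (b * a) = a * b * a from (mul_assoc _ _ _).symm) m
    calc altProd a b (m + 1) = a * ((b * a) ^ m * altProd a b m) := by rw [altProd, ih hb ha]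
      _ = (a * b) ^ m * a * (b * b) * altProd a b m := by rw [hb, mul_one, ← shift, mul_assoc]
      _ = (a * b) ^ (m + 1) * altProd b a (m + 1) := by
        rw [pow_succ, altProd]; simp only [mul_assoc]

theorem orderOf_dvd_of_altProd_eq {G : Type*} [Group G] {a b : G} (ha : a * a = 1)
    (hb : b * b = 1) {m : ℕ} (h : altProd a b m = altProd b a m) : orderOf (a * b) ∣ m := by
  rw [altProd_eq_pow_mul ha hb, mul_eq_right] at h
  exact orderOf_dvd_of_pow_eq_one h

end Alternating

/-- A system of signs for the involutions `s i` of a group: `L i w` plays the role of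
"the root `w⁻¹ α_i` is positive". These are the conditions of Bourbaki, *Lie*, IV, §1, no. 7,
Proposition 6, with `P_{s i} = {w | L i w}`. -/
structure IsSignSystem {G ι : Type*} [Group G] (s : ι → G) (L : ι → G → Prop) : Prop where
  mul_self : ∀ i, s i * s i = 1
  one : ∀ i, L i 1
  anti : ∀ i w, L i w → ¬ L i (s i * w)
  exchange : ∀ i j w, L i w → ¬ L i (w * s j) → s i * w = w * s j

/-- Some reduced word of `w` begins with `x`. -/
def HasReducedPrefix {G ι : Type*} [Group G] (s : ι → G) (w : G) (x : List ι) : Prop :=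
  ∃ z, IsReducedWord s (x ++ z) ∧ ((x ++ z).map s).prod = w

namespace IsSignSystem

variable {G ι : Type*} [Group G] {s : ι → G} {L : ι → G → Prop}

theorem exchange_mul_prod (h : IsSignSystem s L) {i : ι} {l : List ι} {x : G} (hx : L i x)
    (hl : ¬ L i (x * (l.map s).prod)) :
    ∃ l' : List ι, l'.length + 1 = l.length ∧
      s i * (x * (l.map s).prod) = x * (l'.map s).prod := by
  induction l generalizing x with
  | nil => exact absurd (by simpa using hx) hl
  | cons j u ih =>
    rw [List.map_cons, List.prod_cons, ← mul_assoc x] at hl ⊢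
    by_cases hj : L i (x * s j)
    · obtain ⟨u', hu, e⟩ := ih hj hl
      exact ⟨j :: u', by simp [hu], by rw [e]; simp [mul_assoc]⟩
    · refine ⟨u, rfl, ?_⟩
      rw [← mul_assoc, ← mul_assoc (s i), h.exchange i j x hx hj, mul_assoc x, h.mul_self, mul_one]

theorem exchange_prod (h : IsSignSystem s L) {i : ι} {l : List ι} (hl : ¬ L i (l.map s).prod) :
    ∃ l' : List ι, l'.length + 1 = l.length ∧ s i * (l.map s).prod = (l'.map s).prod := by
  simpa using h.exchange_mul_prod (h.one i) (l := l) (by simpa using hl)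

theorem sign_of_isReducedWord_cons (h : IsSignSystem s L) {i : ι} {u : List ι}
    (hr : IsReducedWord s (i :: u)) : L i (u.map s).prod := by
  by_contra hL
  obtain ⟨l', hl, e⟩ := h.exchange_prod hL
  have := hr l' (by simpa using e.symm)
  grind

theorem not_sign_of_isReducedWord_cons (h : IsSignSystem s L) {i : ι} {u : List ι}
    (hr : IsReducedWord s (i :: u)) : ¬ L i ((i :: u).map s).prod := by
  simpa using h.anti i _ (h.sign_of_isReducedWord_cons hr)

theorem sign_altProd (h : IsSignSystem s L) {a b : ι} {p : ℕ}
    (hr : IsReducedWord s (altList b a p))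
    (hp : altProd (s a) (s b) p = altProd (s b) (s a) p → p = 0) :
    L b (altProd (s a) (s b) p) := by
  rcases p with _ | p
  · exact h.one b
  have sign : L b (altProd (s a) (s b) p) := by
    rw [← prod_map_altList]
    exact h.sign_of_isReducedWord_cons hr
  by_contra hL
  obtain ⟨c, hc⟩ := exists_altProd_succ_eq s a b p
  rw [hc] at hL hp
  exact p.succ_ne_zero (hp (h.exchange b c _ sign hL).symm)

theorem hasReducedPrefix_altList_succ (h : IsSignSystem s L) {w : G} {a b : ι} {p : ℕ}
    (hb : ¬ L b w) (hp : altProd (s a) (s b) p = altProd (s b) (s a) p → p = 0)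
    (hab : HasReducedPrefix s w (altList a b p)) (hba : HasReducedPrefix s w (altList b a p)) :
    HasReducedPrefix s w (altList b a (p + 1)) := by
  obtain ⟨y, hy, -⟩ := hba
  obtain ⟨z, hz, rfl⟩ := hab
  have sign := h.sign_altProd hy.of_append_left hp
  rw [List.map_append, List.prod_append, prod_map_altList] at hb ⊢
  obtain ⟨z', hz', e⟩ := h.exchange_mul_prod sign hb
  have eq : ((altList b a (p + 1) ++ z').map s).prod =
      altProd (s a) (s b) p * (z.map s).prod := by
    rw [List.map_append, List.prod_append, prod_map_altList, altProd, mul_assoc, ← e, ← mul_assoc,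
      h.mul_self, one_mul]
  refine ⟨z', hz.of_length_le ?_ ?_, eq⟩
  · rw [eq, List.map_append, List.prod_append, prod_map_altList]
  · simp only [List.length_append, length_altList]
    omega

theorem hasReducedPrefix_altList (h : IsSignSystem s L) {w : G} {i j : ι}
    (hw : HasReducedPrefix s w []) (hi : ¬ L i w) (hj : ¬ L j w) (p : ℕ)
    (hp : ∀ q < p, altProd (s i) (s j) q = altProd (s j) (s i) q → q = 0) :
    HasReducedPrefix s w (altList i j p) ∧ HasReducedPrefix s w (altList j i p) := by
  induction p with
  | zero => exact ⟨hw, hw⟩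
  | succ p ih =>
    obtain ⟨hij, hji⟩ := ih fun q hq => hp q (hq.trans p.lt_succ_self)
    have hp := hp p p.lt_succ_self
    exact ⟨h.hasReducedPrefix_altList_succ hi (fun e => hp e.symm) hji hij,
      h.hasReducedPrefix_altList_succ hj hp hij hji⟩

/-- If both `s i` and `s j` shorten `w`, then the longest element of the dihedral group that they
generate splits off from `w` on the left. -/
theorem exists_reduced_altList_append (h : IsSignSystem s L) {i j : ι} {l : List ι}
    (hl : IsReducedWord s l) (hi : ¬ L i (l.map s).prod) (hj : ¬ L j (l.map s).prod) :
    ∃ (m : ℕ) (z : List ι), orderOf (s i * s j) = m + 1 ∧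
      (IsReducedWord s (altList i j (m + 1) ++ z) ∧
        ((altList i j (m + 1) ++ z).map s).prod = (l.map s).prod) ∧
      IsReducedWord s (altList j i (m + 1) ++ z) ∧
        ((altList j i (m + 1) ++ z).map s).prod = (l.map s).prod := by
  have hw : HasReducedPrefix s (l.map s).prod [] := ⟨l, hl, rfl⟩
  have order_dvd : ∀ q, altProd (s i) (s j) q = altProd (s j) (s i) q → orderOf (s i * s j) ∣ q :=
    fun q => orderOf_dvd_of_altProd_eq (h.mul_self i) (h.mul_self j)
  have order_ne : orderOf (s i * s j) ≠ 0 := by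
    intro h0
    obtain ⟨⟨z, hz, e⟩, -⟩ := h.hasReducedPrefix_altList hw hi hj (l.length + 1)
      fun q _ hq => by simpa [h0] using order_dvd q hq
    have := hz l e.symm
    simp only [List.length_append, length_altList] at this
    omega
  obtain ⟨⟨z, hz, e⟩, -⟩ := h.hasReducedPrefix_altList hw hi hj (orderOf (s i * s j))
    fun q hlt hq => Nat.eq_zero_of_dvd_of_lt (order_dvd q hq) hlt
  obtain ⟨m, hm⟩ := Nat.exists_eq_succ_of_ne_zero order_ne
  have braid : altProd (s i) (s j) (m + 1) = altProd (s j) (s i) (m + 1) := by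
    rw [altProd_eq_pow_mul (h.mul_self i) (h.mul_self j), ← Nat.succ_eq_add_one, ← hm,
      pow_orderOf_eq_one, one_mul]
  rw [hm] at hz e
  have swap : ((altList j i (m + 1) ++ z).map s).prod =
      ((altList i j (m + 1) ++ z).map s).prod := by
    simp only [List.map_append, List.prod_append, prod_map_altList, braid]
  exact ⟨m, z, hm, ⟨hz, e⟩, hz.of_length_le swap (by simp [length_altList]), swap.trans e⟩

theorem prod_map_eq_of_isReducedWord (h : IsSignSystem s L) {M : Type*} [Monoid M] {T : ι → M}
    (hT : ∀ i j, altProd (T i) (T j) (orderOf (s i * s j)) =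
      altProd (T j) (T i) (orderOf (s i * s j)))
    {l l' : List ι} (hl : IsReducedWord s l) (hl' : IsReducedWord s l')
    (e : (l.map s).prod = (l'.map s).prod) : (l.map T).prod = (l'.map T).prod := by
  induction hn : l.length generalizing l l' with
  | zero =>
    have := hl' l e
    rw [List.length_eq_zero_iff.1 hn, List.length_eq_zero_iff.1 (by omega : l'.length = 0)]
  | succ n ih =>
    have same_head : ∀ {a : ι} {u u' : List ι}, IsReducedWord s (a :: u) →
        IsReducedWord s (a :: u') → ((a :: u).map s).prod = ((a :: u').map s).prod →
        u.length = n → ((a :: u).map T).prod = ((a :: u').map T).prod := by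
      intro a u u' hu hu' huu hun
      simp only [List.map_cons, List.prod_cons, mul_right_inj] at huu ⊢
      rw [ih hu.of_cons hu'.of_cons huu hun]
    have hlen : l.length = l'.length := le_antisymm (hl l' e.symm) (hl' l e)
    obtain ⟨i, u, rfl⟩ := List.exists_cons_of_length_eq_add_one hn
    obtain ⟨j, u', rfl⟩ := List.exists_cons_of_length_eq_add_one (hlen.symm.trans hn)
    obtain ⟨m, z, hm, ⟨hij, eij⟩, hji, eji⟩ := h.exists_reduced_altList_append hl
      (h.not_sign_of_isReducedWord_cons hl) (e ▸ h.not_sign_of_isReducedWord_cons hl')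
    calc ((i :: u).map T).prod = ((altList i j (m + 1) ++ z).map T).prod :=
          same_head hl hij eij.symm (by simpa using hn)
      _ = ((altList j i (m + 1) ++ z).map T).prod := by
          simp only [List.map_append, List.prod_append, prod_map_altList, ← hm]
          rw [hT i j]
      _ = ((j :: u').map T).prod :=
          (same_head hl' hji (e.symm.trans eji.symm) (by simpa [hn] using hlen.symm)).symm

theorem prod_map_reverse (h : IsSignSystem s L) (l : List ι) :
    (l.reverse.map s).prod = (l.map s).prod⁻¹ := by
  rw [List.prod_inv_reverse, List.map_reverse, List.map_map]
  congr 2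
  exact List.map_congr_left fun i _ => eq_inv_of_mul_eq_one_left (h.mul_self i)

theorem isReducedWord_concat (h : IsSignSystem s L) {l : List ι} (hl : IsReducedWord s l) {i : ι}
    (hi : L i ((l.map s).prod)⁻¹) : IsReducedWord s (l ++ [i]) := by
  intro l' hl'
  have inv : s i * (l.map s).prod⁻¹ = (l'.reverse.map s).prod := by
    rw [h.prod_map_reverse, hl']
    simp [inv_eq_of_mul_eq_one_left (h.mul_self i)]
  obtain ⟨m, hm, e⟩ := h.exchange_prod (inv ▸ h.anti i _ hi)
  rw [← inv, ← mul_assoc, h.mul_self, one_mul] at e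
  have := hl m.reverse (by rw [h.prod_map_reverse, ← e, inv_inv])
  simp only [List.length_reverse, List.length_append, List.length_singleton] at this hm ⊢
  omega

end IsSignSystem

/-! ### Symmetric affine permutations -/

section Node

variable {r : ℕ}

theorem node_two_mul_add_one (r : ℕ) : (2 * r + 1 : Node r) = 0 := by
  exact_mod_cast ZMod.natCast_self (2 * r + 1)

theorem intCast_node_eq_iff {x y : ℤ} :
    (x : Node r) = y ↔ ∃ q : ℤ, x = y + q * (2 * r + 1) := by
  rw [eq_comm, ZMod.intCast_eq_intCast_iff_dvd_sub]
  refine exists_congr fun q => ?_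
  push_cast
  constructor <;> intro h <;> linarith

theorem intCast_node_ne_zero {x : ℤ} (h₀ : x ≠ 0) (h₁ : |x| ≤ 2 * r) : (x : Node r) ≠ 0 := by
  rw [Ne, ZMod.intCast_zmod_eq_zero_iff_dvd]
  intro h
  have := Int.le_of_dvd (abs_pos.2 h₀) ((dvd_abs _ _).2 h)
  push_cast at this
  omega

theorem intCast_node_inj {x y : ℤ} (h : |x - y| ≤ 2 * r) : (x : Node r) = y ↔ x = y := by
  refine ⟨fun e => ?_, congrArg _⟩
  by_contra hne
  exact intCast_node_ne_zero (sub_ne_zero.2 hne) h (by rw [Int.cast_sub, e, sub_self])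

theorem node_one_ne_zero [NeZero r] : (1 : Node r) ≠ 0 := by
  have := NeZero.pos r
  exact_mod_cast intCast_node_ne_zero (r := r) (x := 1) one_ne_zero (by norm_num; omega)

theorem node_two_ne_zero [NeZero r] : (2 : Node r) ≠ 0 := by
  have := NeZero.pos r
  exact_mod_cast intCast_node_ne_zero (r := r) (x := 2) two_ne_zero (by norm_num; omega)

theorem node_two_mul_ne_zero {i : ℕ} (h₀ : 1 ≤ i) (hi : i ≤ r) : (2 * i : Node r) ≠ 0 := by
  exact_mod_cast intCast_node_ne_zero (r := r) (x := 2 * i) (by omega) (by rw [abs_le]; omega)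

theorem node_two_mul_add_one_ne_zero {i : ℕ} (hi : i < r) : (2 * i + 1 : Node r) ≠ 0 := by
  exact_mod_cast intCast_node_ne_zero (r := r) (x := 2 * i + 1) (by omega) (by rw [abs_le]; omega)

theorem node_two_mul_sub_one_ne_zero {i : ℕ} (hi : i < r) : (2 * i - 1 : Node r) ≠ 0 := by
  exact_mod_cast intCast_node_ne_zero (r := r) (x := 2 * i - 1) (by omega) (by rw [abs_le]; omega)

end Node

/-- The permutations of `ℤ` that commute with the shift by the period `2r + 1`. -/
def periodicPerm (r : ℕ) : Subgroup (Equiv.Perm ℤ) :=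
  Subgroup.centralizer {Equiv.addRight (2 * r + 1 : ℤ)}

/-- The periodic permutations of `ℤ` that also commute with `x ↦ 1 - x`. The relative affine Weyl
group is realized inside this group, `τ` being induced by `x ↦ 1 - x`. -/
def symmetricPerm (r : ℕ) : Subgroup (Equiv.Perm ℤ) :=
  periodicPerm r ⊓ Subgroup.centralizer {Equiv.subLeft (1 : ℤ)}

theorem mem_periodicPerm {r : ℕ} {f : Equiv.Perm ℤ} :
    f ∈ periodicPerm r ↔ ∀ x, f (x + (2 * r + 1)) = f x + (2 * r + 1) := by
  rw [periodicPerm, Subgroup.mem_centralizer_singleton_iff, Equiv.ext_iff]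
  rfl

theorem mem_symmetricPerm {r : ℕ} {f : Equiv.Perm ℤ} :
    f ∈ symmetricPerm r ↔ f ∈ periodicPerm r ∧ ∀ x, f (1 - x) = 1 - f x := by
  rw [symmetricPerm, Subgroup.mem_inf, Subgroup.mem_centralizer_singleton_iff, Equiv.ext_iff]
  rfl

section Periodic

variable {r : ℕ} {f : Equiv.Perm ℤ}

theorem apply_add_mul_period (hf : f ∈ periodicPerm r) (x q : ℤ) :
    f (x + q * (2 * r + 1)) = f x + q * (2 * r + 1) := by
  let g : AddConstMap ℤ ℤ (2 * r + 1) (2 * r + 1) := ⟨f, mem_periodicPerm.1 hf⟩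
  exact AddConstMapClass.map_add_zsmul g x q

theorem intCast_apply_eq_iff (hf : f ∈ periodicPerm r) {x y : ℤ} :
    (f x : Node r) = f y ↔ (x : Node r) = y := by
  simp only [intCast_node_eq_iff, ← apply_add_mul_period hf, f.injective.eq_iff]

theorem intCast_apply_eq_one_sub_iff (hf : f ∈ symmetricPerm r) {x y : ℤ} :
    (f x : Node r) = 1 - f y ↔ (x : Node r) = 1 - y := by
  have h := intCast_apply_eq_iff (mem_symmetricPerm.1 hf).1 (x := x) (y := 1 - y)
  rw [(mem_symmetricPerm.1 hf).2] at h
  exact_mod_cast h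

theorem apply_reflect_center (hf : f ∈ symmetricPerm r) (x : ℤ) :
    f (2 * r + 2 - x) = 2 * r + 2 - f x := by
  obtain ⟨hp, hs⟩ := mem_symmetricPerm.1 hf
  rw [show 2 * r + 2 - x = 1 - x + (2 * r + 1) by ring, mem_periodicPerm.1 hp, hs]
  ring

theorem apply_center (hf : f ∈ symmetricPerm r) : f (r + 1) = r + 1 := by
  have h := apply_reflect_center hf (r + 1)
  rw [show 2 * (r : ℤ) + 2 - (r + 1) = r + 1 by ring] at h
  omega

end Periodic

section Reflections

variable {r : ℕ}

/-- The map that exchanges `x + q(2r + 1)` with `y + q(2r + 1)` and `1 - x + q(2r + 1)` with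
`1 - y + q(2r + 1)`, for all `q`. -/
def reflFun (r : ℕ) (x y z : ℤ) : ℤ :=
  if (z : Node r) = x ∨ (z : Node r) = 1 - y then z + (y - x)
  else if (z : Node r) = y ∨ (z : Node r) = 1 - x then z - (y - x)
  else z

/-- The condition under which `reflFun r x y` is a reflection. -/
structure IsReflPair (r : ℕ) (x y : ℤ) : Prop where
  ne : (x : Node r) ≠ y
  left : (x : Node r) ≠ 1 - x
  right : (y : Node r) ≠ 1 - y

theorem apply_reflFun {f : Equiv.Perm ℤ} (hf : f ∈ symmetricPerm r) (x y z : ℤ) :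
    f (reflFun r x y z) = reflFun r (f x) (f y) (f z) := by
  obtain ⟨hp, hs⟩ := mem_symmetricPerm.1 hf
  have map_add_sub : ∀ {a b c : ℤ}, (a : Node r) = b → f (a + (c - b)) = f a + (f c - f b) := by
    intro a b c hab
    obtain ⟨q, rfl⟩ := intCast_node_eq_iff.1 hab
    rw [show b + q * (2 * r + 1) + (c - b) = c + q * (2 * r + 1) by ring,
      apply_add_mul_period hp, apply_add_mul_period hp]
    ring
  have map_add_sub_reflected : ∀ {a b c : ℤ}, (a : Node r) = 1 - b →
      f (a + (b - c)) = f a + (f b - f c) := by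
    intro a b c hab
    have := map_add_sub (c := 1 - c) (show (a : Node r) = (1 - b : ℤ) by exact_mod_cast hab)
    rw [hs, hs] at this
    convert this using 2 <;> ring
  simp only [reflFun, intCast_apply_eq_iff hp, intCast_apply_eq_one_sub_iff hf]
  split_ifs with h h'
  · exact h.elim map_add_sub map_add_sub_reflected
  · rw [sub_eq_add_neg, neg_sub, h'.elim map_add_sub map_add_sub_reflected]
    ring
  · rfl

theorem reflFun_involutive {x y : ℤ} (h : IsReflPair r x y) :
    Function.Involutive (reflFun r x y) := by
  obtain ⟨hne, hx, hy⟩ := h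
  intro z
  obtain ⟨w, hw⟩ : ∃ w, reflFun r x y z = w := ⟨_, rfl⟩
  have cast : (w : Node r) = if (z : Node r) = x ∨ (z : Node r) = 1 - y then (z : Node r) + (y - x)
      else if (z : Node r) = y ∨ (z : Node r) = 1 - x then (z : Node r) - (y - x) else z := by
    rw [← hw, reflFun]
    split_ifs <;> push_cast <;> rfl
  rw [hw]
  simp only [reflFun] at hw ⊢
  grind

theorem reflFun_eq_of_reflFun_apply_eq {x y x' y' : ℤ} (h' : IsReflPair r x' y') (hne : x ≠ y)
    (h : reflFun r x' y' x = y) : reflFun r x y = reflFun r x' y' := by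
  obtain ⟨hne', hx', hy'⟩ := h'
  funext z
  subst h
  unfold reflFun at hne ⊢
  split_ifs at hne ⊢ <;> grind

/-- The reflection in `symmetricPerm r` that exchanges `x` and `y`. -/
def reflPerm (r : ℕ) (x y : ℤ) (h : IsReflPair r x y) : symmetricPerm r :=
  ⟨(reflFun_involutive h).toPerm, by
    obtain ⟨hne, hx, hy⟩ := h
    have period := node_two_mul_add_one r
    refine mem_symmetricPerm.2 ⟨mem_periodicPerm.2 fun z => ?_, fun z => ?_⟩
    · simp only [Function.Involutive.coe_toPerm, reflFun]
      push_cast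
      rw [period, add_zero]
      split_ifs <;> ring
    · simp only [Function.Involutive.coe_toPerm, reflFun]
      push_cast
      grind⟩

end Reflections

section Generators

variable {r : ℕ}

/-- The reflection realizing `𝐫_i` exchanges `i` with `rightEnd r i`; the latter skips the fixed
point `r + 1` when `i = r`. -/
def rightEnd (r i : ℕ) : ℤ := if i < r then i + 1 else r + 2

theorem lt_rightEnd {i : ℕ} (hi : i ≤ r) : (i : ℤ) < rightEnd r i := by
  unfold rightEnd
  split_ifs <;> omega

theorem reflFun_rightEnd_of_lt {i : ℕ} (hi : i < r) (x : ℤ) :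
    reflFun r i (rightEnd r i) x =
      if (x : Node r) = i ∨ (x : Node r) = -i then x + 1
      else if (x : Node r) = i + 1 ∨ (x : Node r) = 1 - i then x - 1 else x := by
  have neg : (1 - (i + 1) : Node r) = -i := by ring
  simp only [reflFun, rightEnd, if_pos hi, add_sub_cancel_left]
  push_cast
  rw [neg]

theorem reflFun_rightEnd_last (x : ℤ) :
    reflFun r r (rightEnd r r) x =
      if (x : Node r) = r then x + 2 else if (x : Node r) = r + 2 then x - 2 else x := by
  have period := node_two_mul_add_one r
  simp only [reflFun, rightEnd, lt_irrefl, if_false]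
  push_cast
  grind

variable [NeZero r]

theorem isReflPair_rightEnd {i : ℕ} (hi : i ≤ r) : IsReflPair r i (rightEnd r i) := by
  have one_ne := node_one_ne_zero (r := r)
  have two_ne := node_two_ne_zero (r := r)
  have period := node_two_mul_add_one r
  rcases hi.lt_or_eq with hi | rfl
  · have add_ne := node_two_mul_add_one_ne_zero hi
    have sub_ne := node_two_mul_sub_one_ne_zero hi
    rw [show rightEnd r i = i + 1 from if_pos hi]
    constructor <;> push_cast <;> grind
  · rw [show rightEnd i i = i + 2 from if_neg (lt_irrefl i)]
    constructor <;> push_cast <;> grind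

theorem eq_of_reflFun_rightEnd_le {j : ℕ} (hj : j ≤ r) {x y : ℤ} (hxy : x < y)
    (hx : (x : Node r) ≠ 1 - x) (hy : (y : Node r) ≠ 1 - y)
    (h : reflFun r j (rightEnd r j) y ≤ reflFun r j (rightEnd r j) x) :
    reflFun r j (rightEnd r j) x = y := by
  have one_ne := node_one_ne_zero (r := r)
  have two_ne := node_two_ne_zero (r := r)
  rcases hj.lt_or_eq with hj | rfl
  · have add_ne := node_two_mul_add_one_ne_zero hj
    have sub_ne := node_two_mul_sub_one_ne_zero hj
    simp only [reflFun_rightEnd_of_lt hj] at h ⊢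
    have : y = x + 1 ∨ y = x + 2 := by grind
    rcases this with rfl | rfl <;> grind
  · have period := node_two_mul_add_one j
    simp only [reflFun_rightEnd_last] at h ⊢
    have : y = x + 1 ∨ y = x + 2 ∨ y = x + 3 ∨ y = x + 4 := by grind
    rcases this with rfl | rfl | rfl | rfl <;> grind

/-- The symmetric affine permutation corresponding to `𝐫_i`. -/
def relPerm (i : Fin (r + 1)) : symmetricPerm r :=
  reflPerm r i (rightEnd r i) (isReflPair_rightEnd i.is_le)

theorem relPerm_apply (i : Fin (r + 1)) (x : ℤ) :
    (relPerm i).1 x = reflFun r i (rightEnd r i) x := rfl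

theorem relPerm_mul_self (i : Fin (r + 1)) : relPerm i * relPerm i = 1 :=
  Subtype.ext <| Equiv.ext <| reflFun_involutive (isReflPair_rightEnd i.is_le)

theorem inv_relPerm (i : Fin (r + 1)) : (relPerm i)⁻¹ = relPerm i :=
  inv_eq_of_mul_eq_one_left (relPerm_mul_self i)

theorem relPerm_apply_left (i : Fin (r + 1)) : (relPerm i).1 i = rightEnd r i := by
  rw [relPerm_apply, reflFun, if_pos (.inl rfl), add_sub_cancel]

theorem relPerm_apply_right (i : Fin (r + 1)) : (relPerm i).1 (rightEnd r i) = i := by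
  rw [← relPerm_apply_left, relPerm_apply, relPerm_apply,
    reflFun_involutive (isReflPair_rightEnd i.is_le)]

/-- The sign of `w⁻¹ α_i` for a symmetric affine permutation `w`. -/
def PosSign (i : Fin (r + 1)) (w : symmetricPerm r) : Prop :=
  (w⁻¹).1 i < (w⁻¹).1 (rightEnd r i)

theorem relPerm_mul_eq_of_posSign {i j : Fin (r + 1)} {w : symmetricPerm r} (h : PosSign i w)
    (h' : ¬ PosSign i (w * relPerm j)) : relPerm i * w = w * relPerm j := by
  have pair := isReflPair_rightEnd (r := r) i.is_le
  rw [PosSign, mul_inv_rev, inv_relPerm] at h'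
  have flip : reflFun r j (rightEnd r j) ((w⁻¹).1 i) = (w⁻¹).1 (rightEnd r i) :=
    eq_of_reflFun_rightEnd_le j.is_le h
      (mt (intCast_apply_eq_one_sub_iff (w⁻¹).2).1 pair.left)
      (mt (intCast_apply_eq_one_sub_iff (w⁻¹).2).1 pair.right) (not_lt.1 h')
  have same := reflFun_eq_of_reflFun_apply_eq (isReflPair_rightEnd j.is_le) h.ne flip
  ext x
  calc reflFun r i (rightEnd r i) (w.1 x)
      = reflFun r (w.1 ((w⁻¹).1 i)) (w.1 ((w⁻¹).1 (rightEnd r i))) (w.1 x) := by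
        simp
    _ = w.1 (reflFun r ((w⁻¹).1 i) ((w⁻¹).1 (rightEnd r i)) x) := (apply_reflFun w.2 ..).symm
    _ = w.1 (reflFun r j (rightEnd r j) x) := by rw [same]

theorem isSignSystem_relPerm : IsSignSystem (relPerm (r := r)) PosSign where
  mul_self := relPerm_mul_self
  one i := lt_rightEnd i.is_le
  anti i w h := by
    rw [PosSign, mul_inv_rev, inv_relPerm, not_lt]
    change (w⁻¹).1 ((relPerm i).1 (rightEnd r i)) ≤ (w⁻¹).1 ((relPerm i).1 i)
    rw [relPerm_apply_left, relPerm_apply_right]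
    exact h.le
  exchange _ _ _ := relPerm_mul_eq_of_posSign

end Generators

/-! ### The action of periodic permutations on the root lattice -/

section RootVec

variable {r : ℕ}

/-- The vectors with `rootVec 0 = 0` and `rootVec (a + 1) - rootVec a = α_a`, indices modulo
`2r + 1`. They let periodic permutations act on the root lattice, up to translation, through their
action on `ℤ`. -/
def rootVec (r : ℕ) (a : ℤ) : RootLattice r := fun j => -((j.val - a) / (2 * r + 1))

theorem rootVec_add_mul_period (a q : ℤ) :
    rootVec r (a + q * (2 * r + 1)) = rootVec r a + q • delta r := by
  ext j
  rw [Pi.add_apply, Pi.smul_apply, delta_apply, smul_eq_mul, mul_one, rootVec, rootVec,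
    show (j.val : ℤ) - (a + q * (2 * r + 1)) = j.val - a + (-q) * (2 * r + 1) by ring,
    Int.add_mul_ediv_right _ _ (by omega)]
  ring

theorem rootVec_add_one (a : ℤ) : rootVec r (a + 1) = rootVec r a + simpleRoot r a := by
  ext j
  have hj : ((j.val : ℤ) : Node r) = j := by simp
  have hd : j = (a : Node r) ↔ (2 * r + 1 : ℤ) ∣ j.val - a := by
    rw [eq_comm, ← hj, ZMod.intCast_eq_intCast_iff_dvd_sub, hj]
    norm_cast
  rw [Pi.add_apply, simpleRoot, Pi.single_apply, rootVec, rootVec, ← sub_sub]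
  generalize (j.val : ℤ) - a = d at hd ⊢
  have e := Int.emod_add_mul_ediv d (2 * r + 1)
  have h₀ := Int.emod_nonneg d (show (2 * r + 1 : ℤ) ≠ 0 by omega)
  have h₁ := Int.emod_lt_of_pos d (show (0 : ℤ) < 2 * r + 1 by omega)
  have step : ∀ q m : ℤ, m + (2 * r + 1) * q = d - 1 → 0 ≤ m → m < 2 * r + 1 →
      (d - 1) / (2 * r + 1) = q := fun q m h h₀ h₁ =>
    ((Int.ediv_emod_unique (by omega)).2 ⟨h, h₀, h₁⟩).1
  split_ifs with h
  · have := Int.emod_eq_zero_of_dvd (hd.1 h)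
    rw [step (d / (2 * r + 1) - 1) (2 * r) (by linarith) (by omega) (by omega)]
    ring
  · have := mt Int.dvd_of_emod_eq_zero (mt hd.2 h)
    rw [step (d / (2 * r + 1)) (d % (2 * r + 1) - 1) (by linarith) (by omega) (by omega), add_zero]

theorem rootVec_add_one_sub (a : ℤ) : rootVec r (a + 1) - rootVec r a = simpleRoot r a := by
  rw [rootVec_add_one, add_sub_cancel_left]

theorem rootVec_strictMono (r : ℕ) : StrictMono (rootVec r) :=
  strictMono_int_of_lt_succ fun a => by
    rw [rootVec_add_one, lt_add_iff_pos_right, simpleRoot, Pi.single_pos]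
    exact one_pos

end RootVec

section PermRep

variable {r : ℕ}

/-- The endomorphism of the root lattice induced by the map `rootVec a ↦ rootVec (f a)`, for a
periodic `f`. -/
noncomputable def permEnd (r : ℕ) (f : Equiv.Perm ℤ) : Module.End ℤ (RootLattice r) :=
  (Pi.basisFun ℤ (Node r)).constr ℤ fun j => rootVec r (f (j.val + 1)) - rootVec r (f j.val)

theorem permEnd_simpleRoot {f : Equiv.Perm ℤ} (hf : f ∈ periodicPerm r) (a : ℤ) :
    permEnd r f (simpleRoot r a) = rootVec r (f (a + 1)) - rootVec r (f a) := by
  obtain ⟨q, hq⟩ : ∃ q : ℤ, a = (a : Node r).val + q * (2 * r + 1) :=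
    intCast_node_eq_iff.1 (by simp)
  have basis : simpleRoot r a = Pi.basisFun ℤ (Node r) a := (Pi.basisFun_apply ..).symm
  rw [basis, permEnd, Module.Basis.constr_basis]
  generalize (a : Node r).val = b at hq ⊢
  rw [hq, add_right_comm, apply_add_mul_period hf, apply_add_mul_period hf,
    rootVec_add_mul_period, rootVec_add_mul_period, add_sub_add_right_eq_sub]

theorem permEnd_rootVec_sub {f : Equiv.Perm ℤ} (hf : f ∈ periodicPerm r) (a b : ℤ) :
    permEnd r f (rootVec r b - rootVec r a) = rootVec r (f b) - rootVec r (f a) := by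
  have const : Function.Periodic (fun a => permEnd r f (rootVec r a) - rootVec r (f a)) 1 :=
    fun a => by
      have h := permEnd_simpleRoot hf a
      rw [← rootVec_add_one_sub, map_sub] at h
      exact sub_eq_sub_iff_sub_eq_sub.1 h
  have h := (const.int_mul_eq b).trans (const.int_mul_eq a).symm
  simp only [Int.cast_id, mul_one] at h
  rw [map_sub]
  exact sub_eq_sub_iff_sub_eq_sub.1 h

theorem endomorphism_ext {g g' : Module.End ℤ (RootLattice r)}
    (h : ∀ a : ℤ, -r ≤ a → a ≤ r → g (simpleRoot r a) = g' (simpleRoot r a)) : g = g' := by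
  refine (Pi.basisFun ℤ (Node r)).ext fun j => ?_
  have bound : (j.valMinAbs).natAbs ≤ (2 * r + 1) / 2 := ZMod.natAbs_valMinAbs_le j
  have := h j.valMinAbs (by omega) (by omega)
  rwa [ZMod.coe_valMinAbs, simpleRoot, ← Pi.basisFun_apply] at this

/-- The action of periodic permutations on the root lattice, `α_a ↦ rootVec (f (a + 1)) -
rootVec (f a)`. -/
noncomputable def permRep (r : ℕ) : periodicPerm r →* (RootLattice r ≃ₗ[ℤ] RootLattice r) :=
  (LinearMap.GeneralLinearGroup.generalLinearEquiv ℤ (RootLattice r)).toMonoidHom.comp <|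
    MonoidHom.toHomUnits
      { toFun := fun f => permEnd r f
        map_one' := endomorphism_ext fun a _ _ => by
          rw [permEnd_simpleRoot (1 : periodicPerm r).2]
          exact rootVec_add_one_sub a
        map_mul' := fun f g => endomorphism_ext fun a _ _ => by
          rw [permEnd_simpleRoot (f * g).2, Module.End.mul_apply, permEnd_simpleRoot g.2,
            permEnd_rootVec_sub f.2]
          rfl }

theorem permRep_rootVec_sub (f : periodicPerm r) (a b : ℤ) :
    permRep r f (rootVec r b - rootVec r a) = rootVec r (f.1 b) - rootVec r (f.1 a) :=
  permEnd_rootVec_sub f.2 a b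

theorem permRep_simpleRoot (f : periodicPerm r) (a : ℤ) :
    permRep r f (simpleRoot r a) = rootVec r (f.1 (a + 1)) - rootVec r (f.1 a) :=
  permEnd_simpleRoot f.2 a

theorem permRep_eq_of_simpleRoot {f : periodicPerm r} {g : RootLattice r ≃ₗ[ℤ] RootLattice r}
    (h : ∀ a : ℤ, -r ≤ a → a ≤ r →
      rootVec r (f.1 (a + 1)) - rootVec r (f.1 a) = g (simpleRoot r a)) : permRep r f = g :=
  LinearEquiv.toLinearMap_injective <| endomorphism_ext fun a h₀ h₁ =>
    (permRep_simpleRoot f a).trans (h a h₀ h₁)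

/-- The action of symmetric affine permutations on the root lattice. -/
noncomputable def symmetricRep (r : ℕ) : symmetricPerm r →* (RootLattice r ≃ₗ[ℤ] RootLattice r) :=
  (permRep r).comp (Subgroup.inclusion inf_le_left)

theorem symmetricRep_rootVec_sub (f : symmetricPerm r) (a b : ℤ) :
    symmetricRep r f (rootVec r b - rootVec r a) = rootVec r (f.1 b) - rootVec r (f.1 a) :=
  permRep_rootVec_sub _ a b

theorem symmetricRep_injective (r : ℕ) : Function.Injective (symmetricRep r) := by
  intro f g h
  ext x
  have image := symmetricRep_rootVec_sub f (r + 1) x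
  rw [h, symmetricRep_rootVec_sub, apply_center f.2, apply_center g.2, sub_left_inj] at image
  exact (rootVec_strictMono r).injective image.symm

end PermRep

/-! ### Simple and relative reflections as permutations -/

section SimpleReflections

variable {r : ℕ}

/-- The map that exchanges `x` and `x + 1` for all `x` in the class of `i` modulo `2r + 1`. -/
def swapFun (r : ℕ) (i : Node r) (x : ℤ) : ℤ :=
  if (x : Node r) = i then x + 1 else if (x : Node r) = i + 1 then x - 1 else x

theorem intCast_swapFun (i : Node r) (x : ℤ) :
    (swapFun r i x : Node r) = if (x : Node r) = i then (x : Node r) + 1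
      else if (x : Node r) = i + 1 then (x : Node r) - 1 else x := by
  unfold swapFun
  split_ifs <;> push_cast <;> rfl

theorem simpleReflection_simpleRoot (i j : Node r) :
    simpleReflection r i (simpleRoot r j) = simpleRoot r j - cartan r i j • simpleRoot r i := by
  rw [simpleReflection_apply, simpleCoroot_simpleRoot]

variable [NeZero r]

theorem swapFun_involutive (i : Node r) : Function.Involutive (swapFun r i) := by
  have succ_ne : i + 1 ≠ i := by simpa using node_one_ne_zero (r := r)
  intro x
  have cast := intCast_swapFun i x
  generalize hy : swapFun r i x = y at cast ⊢
  simp only [swapFun] at hy ⊢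
  grind

/-- The periodic permutation corresponding to the simple reflection `s_i`. -/
def simplePerm (i : Node r) : periodicPerm r :=
  ⟨(swapFun_involutive i).toPerm, mem_periodicPerm.2 fun x => by
    simp only [Function.Involutive.coe_toPerm, swapFun]
    push_cast
    rw [node_two_mul_add_one r, add_zero]
    split_ifs <;> ring⟩

theorem cartan_eq (i j : Node r) :
    cartan r i j = 2 * (if j = i then 1 else 0) - (if j + 1 = i then 1 else 0) -
      (if j = i + 1 then 1 else 0) := by
  have two_ne := node_two_ne_zero (r := r)
  unfold cartan
  grind

theorem rootVec_swapFun (i : Node r) (a : ℤ) :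
    rootVec r (swapFun r i a) = rootVec r a +
      ((if (a : Node r) = i then 1 else 0) - (if (a : Node r) = i + 1 then 1 else 0) : ℤ) •
        simpleRoot r i := by
  unfold swapFun
  split_ifs with h₀ h₁ h₁
  · exact absurd (h₀.symm.trans h₁) (by simpa using node_one_ne_zero (r := r))
  · rw [rootVec_add_one, h₀, sub_zero, one_smul]
  · have h := rootVec_add_one (r := r) (a - 1)
    rw [Int.cast_sub, Int.cast_one, h₁, add_sub_cancel_right, sub_add_cancel] at h
    rw [h]
    module
  · rw [sub_zero, zero_smul, add_zero]

theorem permRep_simplePerm (i : Node r) : permRep r (simplePerm i) = simpleReflection r i := by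
  refine permRep_eq_of_simpleRoot fun a _ _ => ?_
  change rootVec r (swapFun r i (a + 1)) - rootVec r (swapFun r i a) = _
  rw [rootVec_swapFun, rootVec_swapFun, rootVec_add_one, simpleReflection_simpleRoot, cartan_eq]
  push_cast
  simp only [add_left_inj]
  module

end SimpleReflections

section RelativeReflections

variable {r : ℕ}

theorem relReflection_zero : relReflection r 0 = simpleReflection r 0 := by
  simp [relReflection, cartan, tau]

theorem relReflection_of_lt {i : ℕ} (h₀ : 1 ≤ i) (hi : i < r) :
    relReflection r i = simpleReflection r i * simpleReflection r (-i) := by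
  have two_mul_ne := node_two_mul_ne_zero h₀ hi.le
  have add_ne := node_two_mul_add_one_ne_zero hi
  have sub_ne := node_two_mul_sub_one_ne_zero hi
  have cartan_eq_zero : cartan r i (tau r i) = 0 := by
    unfold cartan tau
    grind
  rw [relReflection, cartan_eq_zero, if_neg (by norm_num), if_pos rfl, tau]

theorem relReflection_last [NeZero r] :
    relReflection r r = simpleReflection r r * simpleReflection r (-r) * simpleReflection r r := by
  have two_mul_ne := node_two_mul_ne_zero (NeZero.pos r) le_rfl
  have period := node_two_mul_add_one r
  have cartan_eq_neg_one : cartan r r (tau r r) = -1 := by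
    unfold cartan tau
    grind
  rw [relReflection, cartan_eq_neg_one, if_neg (by norm_num), if_neg (by norm_num), tau]

theorem relReflection_mem_affineWeylGroup (i : Node r) :
    relReflection r i ∈ affineWeylGroup r := by
  have mem : ∀ j, simpleReflection r j ∈ affineWeylGroup r :=
    fun j => Subgroup.subset_closure ⟨j, rfl⟩
  unfold relReflection
  split_ifs
  · exact mem _
  · exact mul_mem (mem _) (mem _)
  · exact mul_mem (mul_mem (mem _) (mem _)) (mem _)

theorem reflFun_zero_eq_swapFun [NeZero r] (x : ℤ) :
    reflFun r (0 : ℕ) (rightEnd r 0) x = swapFun r 0 x := by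
  rw [reflFun_rightEnd_of_lt (NeZero.pos r), swapFun]
  simp

theorem reflFun_eq_swapFun_swapFun {i : ℕ} (h₀ : 1 ≤ i) (hi : i < r) (x : ℤ) :
    reflFun r i (rightEnd r i) x = swapFun r i (swapFun r (-i) x) := by
  have two_mul_ne := node_two_mul_ne_zero h₀ hi.le
  have add_ne := node_two_mul_add_one_ne_zero hi
  have sub_ne := node_two_mul_sub_one_ne_zero hi
  have cast := intCast_swapFun (r := r) (-i) x
  generalize hy : swapFun r (-i) x = y at cast ⊢
  rw [reflFun_rightEnd_of_lt hi]
  simp only [swapFun] at hy ⊢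
  grind

theorem reflFun_last_eq_swapFun [NeZero r] (x : ℤ) :
    reflFun r r (rightEnd r r) x = swapFun r r (swapFun r (-r) (swapFun r r x)) := by
  have two_ne := node_two_ne_zero (r := r)
  have period := node_two_mul_add_one r
  have cast := intCast_swapFun (r := r) r x
  generalize hy : swapFun r r x = y at cast ⊢
  have cast' := intCast_swapFun (r := r) (-r) y
  generalize hz : swapFun r (-r) y = z at cast' ⊢
  rw [reflFun_rightEnd_last]
  simp only [swapFun] at hy hz ⊢
  grind

variable [NeZero r]

theorem symmetricRep_relPerm (i : Fin (r + 1)) :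
    symmetricRep r (relPerm i) = relReflection r (rep r i) := by
  obtain ⟨i, hi⟩ := i
  have transport : ∀ f : periodicPerm r,
      (∀ x, reflFun r i (rightEnd r i) x = f.1 x) →
        symmetricRep r (relPerm ⟨i, hi⟩) = permRep r f := fun f h =>
    congrArg (permRep r) (Subtype.ext (Equiv.ext h))
  change _ = relReflection r (i : Node r)
  rcases Nat.lt_succ_iff_lt_or_eq.1 hi with hi' | rfl
  · rcases Nat.eq_zero_or_pos i with rfl | h₀
    · rw [Nat.cast_zero, relReflection_zero, ← permRep_simplePerm]
      exact transport _ reflFun_zero_eq_swapFun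
    · rw [relReflection_of_lt h₀ hi', ← permRep_simplePerm, ← permRep_simplePerm, ← map_mul]
      exact transport _ (reflFun_eq_swapFun_swapFun h₀ hi')
  · rw [relReflection_last, ← permRep_simplePerm, ← permRep_simplePerm, ← map_mul, ← map_mul]
    exact transport _ reflFun_last_eq_swapFun

theorem prod_map_relReflection (l : List (Fin (r + 1))) :
    (l.map fun i => relReflection r (rep r i)).prod = symmetricRep r (l.map relPerm).prod := by
  rw [map_list_prod, List.map_map]
  exact congrArg List.prod (List.map_congr_left fun i _ => (symmetricRep_relPerm i).symm)

theorem orderOf_relReflection_mul (i j : Fin (r + 1)) :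
    orderOf (relReflection r (rep r i) * relReflection r (rep r j)) =
      orderOf (relPerm i * relPerm j) := by
  rw [← symmetricRep_relPerm, ← symmetricRep_relPerm, ← map_mul,
    orderOf_injective _ (symmetricRep_injective r)]

end RelativeReflections

/-! ### Words in the relative reflections -/

section Words

variable {r : ℕ}

/-- The word `a, a + 1, …, b`. -/
def upList (r a b : ℕ) : List (Fin (r + 1)) :=
  (List.finRange (r + 1)).filter fun i : Fin (r + 1) => a ≤ (i : ℕ) ∧ (i : ℕ) ≤ b

theorem mem_upList {a b : ℕ} {i : Fin (r + 1)} :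
    i ∈ upList r a b ↔ a ≤ (i : ℕ) ∧ (i : ℕ) ≤ b := by
  simp [upList]

theorem pairwise_upList (r a b : ℕ) : (upList r a b).Pairwise (· < ·) :=
  (List.pairwise_lt_finRange _).filter _

theorem upList_concat {a b : ℕ} (ha : a ≤ b + 1) (hb : b + 1 ≤ r) :
    upList r a (b + 1) = upList r a b ++ [⟨b + 1, Nat.lt_succ_of_le hb⟩] := by
  refine (pairwise_upList _ _ _).eq_of_mem_iff (List.pairwise_append.2
    ⟨pairwise_upList _ _ _, List.pairwise_singleton _ _, fun i hi j hj => ?_⟩) fun i => ?_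
  · rw [List.mem_singleton.1 hj]
    exact Nat.lt_succ_of_le (mem_upList.1 hi).2
  · simp only [List.mem_append, List.mem_singleton, mem_upList, Fin.ext_iff]
    omega

theorem upList_cons {a b : ℕ} (ha : a ≤ b) (hb : b ≤ r) :
    upList r a b = ⟨a, by omega⟩ :: upList r (a + 1) b := by
  refine (pairwise_upList _ _ _).eq_of_mem_iff
    (List.pairwise_cons.2 ⟨fun i hi => (mem_upList.1 hi).1, pairwise_upList _ _ _⟩) fun i => ?_
  simp only [List.mem_cons, mem_upList, Fin.ext_iff]
  omega

theorem upList_eq_nil {a b : ℕ} (h : b < a) : upList r a b = [] :=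
  List.eq_nil_iff_forall_not_mem.2 fun i hi => by
    have := mem_upList.1 hi
    omega

theorem upList_zero_last [NeZero r] : upList r 0 r = upList r 0 (r - 1) ++ [Fin.last r] := by
  obtain ⟨s, rfl⟩ : ∃ s, r = s + 1 := Nat.exists_eq_succ_of_ne_zero (NeZero.ne r)
  exact upList_concat (by omega) le_rfl

theorem length_upList {a b : ℕ} (hb : b ≤ r) : (upList r a b).length = b + 1 - a := by
  induction h : b + 1 - a generalizing a with
  | zero => rw [upList_eq_nil (by omega), List.length_nil]
  | succ n ih => rw [upList_cons (by omega) hb, List.length_cons, ih (by omega)]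

/-- The word `0, 1, …, r - 1, r, r - 1, …, k`. -/
def cycleWord (r k : ℕ) : List (Fin (r + 1)) := upList r 0 r ++ (upList r k (r - 1)).reverse

theorem cycleWord_self (hr : 1 ≤ r) : cycleWord r r = upList r 0 r := by
  rw [cycleWord, upList_eq_nil (show r - 1 < r by omega), List.reverse_nil, List.append_nil]

theorem cycleWord_eq_concat {k : ℕ} (hk : k < r) :
    cycleWord r k = cycleWord r (k + 1) ++ [⟨k, by omega⟩] := by
  rw [cycleWord, upList_cons (a := k) (by omega) (by omega), List.reverse_cons, ← List.append_assoc,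
    cycleWord]

theorem length_cycleWord {k : ℕ} (h₀ : 1 ≤ k) (hk : k ≤ r) :
    (cycleWord r k).length = r + 1 + (r - k) := by
  rw [cycleWord, List.length_append, List.length_reverse, length_upList le_rfl,
    length_upList (by omega)]
  omega

/-- The word `(0, 1, …, r - 1, r, r - 1, …, k)^k`. -/
def varpiWord (r k : ℕ) : List (Fin (r + 1)) := (List.replicate k (cycleWord r k)).flatten

/-- The word `(0, 1, …, r)^(r - 1), 1, 2, …, r - 1`. -/
def varpiPredWord (r : ℕ) : List (Fin (r + 1)) :=
  (List.replicate (r - 1) (cycleWord r r)).flatten ++ upList r 1 (r - 1)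

theorem length_varpiPredWord (hr : 2 ≤ r) :
    (varpiPredWord r).length = (varpiWord r (r - 1)).length := by
  rw [varpiPredWord, varpiWord, List.length_append, length_upList (by omega)]
  simp only [List.length_flatten, List.map_replicate, List.sum_replicate, smul_eq_mul]
  rw [length_cycleWord (by omega) le_rfl, length_cycleWord (by omega) (by omega),
    Nat.sub_self, Nat.sub_sub_self (by omega)]
  simp only [Nat.sub_add_cancel (show 1 ≤ r by omega), add_zero]
  ring

theorem prod_map_flatten_replicate {ι M : Type*} [Monoid M] (s : ι → M) (p : ℕ) (l : List ι) :
    ((List.replicate p l).flatten.map s).prod = (l.map s).prod ^ p := by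
  rw [List.map_flatten, List.prod_flatten, List.map_map, List.map_replicate, List.prod_replicate,
    Function.comp_apply]

end Words

section PermProd

variable {r : ℕ} [NeZero r]

/-- The symmetric affine permutation that a word in the relative reflections spells. -/
def permProd (l : List (Fin (r + 1))) : symmetricPerm r := (l.map relPerm).prod

theorem permProd_singleton (i : Fin (r + 1)) : permProd [i] = relPerm i :=
  List.prod_singleton

theorem permProd_append (l l' : List (Fin (r + 1))) :
    permProd (l ++ l') = permProd l * permProd l' := by
  simp [permProd]

theorem permProd_flatten_replicate (p : ℕ) (l : List (Fin (r + 1))) :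
    permProd (List.replicate p l).flatten = permProd l ^ p :=
  prod_map_flatten_replicate relPerm p l

theorem relPerm_apply_of_lt {i : Fin (r + 1)} (hi : (i : ℕ) < r) {x : ℤ} (h₀ : 1 ≤ x)
    (h₁ : x ≤ r) : (relPerm i).1 x = if x = i then x + 1 else if x = i + 1 then x - 1 else x := by
  have eq_self := intCast_node_inj (r := r) (x := x) (y := i) (by rw [abs_le]; omega)
  have eq_succ := intCast_node_inj (r := r) (x := x) (y := i + 1) (by rw [abs_le]; omega)
  have eq_neg := intCast_node_inj (r := r) (x := x) (y := -i) (by rw [abs_le]; omega)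
  have eq_one_sub := intCast_node_inj (r := r) (x := x) (y := 1 - i) (by rw [abs_le]; omega)
  push_cast at eq_self eq_succ eq_neg eq_one_sub
  simp only [relPerm_apply, reflFun_rightEnd_of_lt hi, eq_self, eq_succ, eq_neg, eq_one_sub]
  split_ifs <;> omega

theorem relPerm_last_apply {x : ℤ} (h₀ : 1 ≤ x) (h₁ : x ≤ r) :
    (relPerm (Fin.last r)).1 x = if x = r then (r : ℤ) + 2 else x := by
  have eq_last := intCast_node_inj (r := r) (x := x) (y := r) (by rw [abs_le]; omega)
  have eq_add_two := intCast_node_inj (r := r) (x := x) (y := r + 2) (by rw [abs_le]; omega)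
  push_cast at eq_last eq_add_two
  simp only [relPerm_apply, Fin.val_last, reflFun_rightEnd_last, eq_last, eq_add_two]
  split_ifs <;> omega

theorem permProd_upList_apply {a b : ℕ} (ha : a ≤ b + 1) (hb : b < r) {x : ℤ} (h₀ : 1 ≤ x)
    (h₁ : x ≤ r) : (permProd (upList r a b)).1 x =
      if a ≤ x ∧ x ≤ b then x + 1 else if x = b + 1 then (a : ℤ) else x := by
  have empty : ∀ b y, (permProd (upList r (b + 1) b)).1 y = y := fun b y => by
    rw [upList_eq_nil b.lt_succ_self]
    rfl
  induction b generalizing x with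
  | zero =>
    rcases Nat.le_one_iff_eq_zero_or_eq_one.1 ha with rfl | rfl
    · rw [upList_cons le_rfl hb.le, upList_eq_nil (by omega), permProd_singleton,
        relPerm_apply_of_lt hb h₀ h₁]
      push_cast
      split_ifs <;> omega
    · rw [empty]
      split_ifs <;> omega
  | succ b ih =>
    rcases ha.lt_or_eq with ha | rfl
    · rw [upList_concat (by omega) hb.le, permProd_append, permProd_singleton, Subgroup.coe_mul,
        Equiv.Perm.mul_apply, relPerm_apply_of_lt hb h₀ h₁]
      push_cast
      split_ifs <;>
        rw [ih (by omega) (by omega) (by omega) (by omega)] <;>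
        split_ifs <;> omega
    · rw [empty]
      split_ifs <;> omega

theorem permProd_cycleWord_apply {k : ℕ} (h₀ : 1 ≤ k) (hk : k ≤ r) {x : ℤ} (hx₀ : 1 ≤ x)
    (hx₁ : x ≤ r) : (permProd (cycleWord r k)).1 x =
      if x < k then x + 1 else if x = k then 2 * r + 2 else x := by
  have hr := NeZero.pos r
  induction hk using Nat.decreasingInduction generalizing x with
  | self =>
    have upList_apply : ∀ {y : ℤ}, 1 ≤ y → y ≤ r →
        (permProd (upList r 0 (r - 1))).1 y = if y < r then y + 1 else 0 := fun h h' => by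
      rw [permProd_upList_apply (by omega) (by omega) h h']
      split_ifs <;> omega
    rw [cycleWord_self hr, upList_zero_last, permProd_append, permProd_singleton,
      Subgroup.coe_mul, Equiv.Perm.mul_apply, relPerm_last_apply hx₀ hx₁]
    rcases hx₁.lt_or_eq with hlt | rfl
    · rw [if_neg hlt.ne, upList_apply hx₀ hx₁, if_pos hlt, if_pos hlt]
    · rw [if_pos rfl, if_neg (lt_irrefl _), if_pos rfl,
        show (r + 2 : ℤ) = 2 * r + 2 - r by ring, apply_reflect_center (Subtype.prop _),
        upList_apply hx₀ le_rfl, if_neg (lt_irrefl _), sub_zero]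
  | of_succ k hk ih =>
    rw [cycleWord_eq_concat hk, permProd_append, permProd_singleton, Subgroup.coe_mul,
      Equiv.Perm.mul_apply, relPerm_apply_of_lt hk hx₀ hx₁]
    push_cast at ih
    dsimp only
    split_ifs <;> rw [ih trivial (by omega) (by omega)] <;> split_ifs <;> omega

theorem permProd_cycleWord_pow_apply {k : ℕ} (h₀ : 1 ≤ k) (hk : k ≤ r) {p : ℕ} (hp : p ≤ k) {x : ℤ}
    (hx₀ : 1 ≤ x) (hx₁ : x ≤ r) : (permProd (cycleWord r k) ^ p).1 x =
      if x + p ≤ k then x + p else if x ≤ k then x + p - k + (2 * r + 1) else x := by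
  induction p generalizing x with
  | zero =>
    rw [pow_zero, Subgroup.coe_one, Equiv.Perm.one_apply]
    split_ifs <;> omega
  | succ p ih =>
    rw [pow_succ, Subgroup.coe_mul, Equiv.Perm.mul_apply, permProd_cycleWord_apply h₀ hk hx₀ hx₁,
      Nat.cast_succ]
    rcases lt_trichotomy x k with hlt | rfl | hgt
    · rw [if_pos hlt, ih (by omega) (by omega) (by omega)]
      split_ifs <;> omega
    · rw [if_neg (lt_irrefl _), if_pos rfl, show 2 * (r : ℤ) + 2 = 1 + (2 * r + 1) by ring,
        mem_periodicPerm.1 (mem_symmetricPerm.1 (Subtype.prop _)).1,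
        ih (by omega) le_rfl (by omega)]
      split_ifs <;> omega
    · rw [if_neg hgt.not_gt, if_neg hgt.ne', ih (by omega) hx₀ hx₁]
      split_ifs <;> omega

theorem permProd_varpiWord_apply {k : ℕ} (h₀ : 1 ≤ k) (hk : k ≤ r) {x : ℤ} (hx₀ : 1 ≤ x)
    (hx₁ : x ≤ r) :
    (permProd (varpiWord r k)).1 x = if x ≤ k then x + (2 * r + 1) else x := by
  rw [varpiWord, permProd_flatten_replicate, permProd_cycleWord_pow_apply h₀ hk le_rfl hx₀ hx₁]
  split_ifs <;> omega

theorem permProd_varpiPredWord_apply (hr : 2 ≤ r) {x : ℤ} (hx₀ : 1 ≤ x) (hx₁ : x ≤ r) :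
    (permProd (varpiPredWord r)).1 x = if x ≤ (r - 1 : ℕ) then x + (2 * r + 1) else x := by
  rw [varpiPredWord, permProd_append, permProd_flatten_replicate, Subgroup.coe_mul,
    Equiv.Perm.mul_apply, permProd_upList_apply (by omega) (by omega) hx₀ hx₁]
  split_ifs <;>
    rw [permProd_cycleWord_pow_apply (NeZero.pos r) le_rfl (Nat.sub_le r 1) (by omega)
      (by omega)] <;>
    split_ifs <;> omega

end PermProd

/-! ### Reducedness of the words of `ϖ_k` -/

section Ascending

variable {r : ℕ} [NeZero r]

/-- The word `l`, read from left to right and starting from the permutation `f`, increases the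
length with each of its letters, in the sense of the sign condition `PosSign`. -/
def IsAscending : symmetricPerm r → List (Fin (r + 1)) → Prop
  | _, [] => True
  | f, i :: l => f.1 i < f.1 (rightEnd r i) ∧ IsAscending (f * relPerm i) l

theorem isAscending_singleton {f : symmetricPerm r} {i : Fin (r + 1)} :
    IsAscending f [i] ↔ f.1 i < f.1 (rightEnd r i) :=
  and_iff_left trivial

theorem isAscending_append {f : symmetricPerm r} {l l' : List (Fin (r + 1))} :
    IsAscending f (l ++ l') ↔ IsAscending f l ∧ IsAscending (f * permProd l) l' := by
  induction l generalizing f with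
  | nil => simp [IsAscending, permProd]
  | cons i l ih => simp [IsAscending, ih, and_assoc, permProd, mul_assoc]

theorem isReducedWord_of_isAscending {l : List (Fin (r + 1))} (h : IsAscending 1 l) :
    IsReducedWord relPerm l := by
  induction l using List.reverseRecOn with
  | nil => exact fun l' _ => Nat.zero_le _
  | append_singleton l i ih =>
    rw [isAscending_append, isAscending_singleton, one_mul] at h
    refine isSignSystem_relPerm.isReducedWord_concat (ih h.1) ?_
    rw [PosSign, inv_inv]
    exact h.2

theorem isAscending_upList_zero {f : symmetricPerm r}
    (hpos : ∀ x : ℤ, 1 ≤ x → x ≤ r → 1 ≤ f.1 x) {b : ℕ} (hb : b ≤ r) :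
    IsAscending f (upList r 0 b) := by
  have hr := NeZero.pos r
  have pos_one : 1 ≤ f.1 1 := hpos 1 le_rfl (by omega)
  have zero_nonpos : f.1 0 ≤ 0 := by
    have := (mem_symmetricPerm.1 f.2).2 1
    rw [sub_self] at this
    omega
  induction b with
  | zero =>
    rw [upList_cons le_rfl hb, upList_eq_nil (by omega), isAscending_singleton]
    simp only [rightEnd, if_pos hr, Nat.cast_zero, zero_add]
    omega
  | succ b ih =>
    have left : (permProd (upList r 0 b)).1 (b + 1) = 0 := by
      rw [permProd_upList_apply (by omega) (by omega) (by omega) (by omega), if_neg (by omega),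
        if_pos rfl, Nat.cast_zero]
    rw [upList_concat (by omega) hb, isAscending_append, isAscending_singleton]
    refine ⟨ih (by omega), ?_⟩
    simp only [Subgroup.coe_mul, Equiv.Perm.mul_apply, Nat.cast_succ, left]
    rcases hb.lt_or_eq with hb | rfl
    · rw [rightEnd, if_pos hb, Nat.cast_succ,
        permProd_upList_apply (by omega) (by omega) (by omega) (by omega), if_neg (by omega),
        if_neg (by omega)]
      have := hpos (b + 1 + 1) (by omega) (by omega)
      omega
    · have reflect : ((b + 1 : ℕ) + 2 : ℤ) = 2 * (b + 1 : ℕ) + 2 - (b + 1) := by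
        push_cast
        ring
      rw [rightEnd, if_neg (lt_irrefl _), reflect, apply_reflect_center (Subtype.prop _), left,
        apply_reflect_center f.2]
      omega

theorem isAscending_cycleWord {f : symmetricPerm r} {k : ℕ} (h₀ : 1 ≤ k) (hk : k ≤ r)
    (hpos : ∀ x : ℤ, 1 ≤ x → x ≤ r → 1 ≤ f.1 x) (hfix : ∀ x : ℤ, k < x → x ≤ r → f.1 x = x) :
    IsAscending f (cycleWord r k) := by
  induction hk using Nat.decreasingInduction with
  | self =>
    rw [cycleWord_self h₀]
    exact isAscending_upList_zero hpos le_rfl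
  | of_succ k hk ih =>
    have left : (permProd (cycleWord r (k + 1))).1 k = k + 1 := by
      rw [permProd_cycleWord_apply (by omega) hk (by omega) (by omega), if_pos (by omega)]
    have right : (permProd (cycleWord r (k + 1))).1 (k + 1) = 1 + (2 * r + 1) := by
      rw [permProd_cycleWord_apply (by omega) hk (by omega) (by omega), if_neg (by omega),
        if_pos (by omega)]
      ring
    rw [cycleWord_eq_concat hk, isAscending_append, isAscending_singleton]
    refine ⟨ih (by omega) fun x hx => hfix x (by omega), ?_⟩
    simp only [Subgroup.coe_mul, Equiv.Perm.mul_apply, rightEnd, if_pos hk, left, right]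
    rw [hfix _ (by omega) (by omega), mem_periodicPerm.1 (mem_symmetricPerm.1 f.2).1]
    have := hpos 1 le_rfl (by omega)
    omega

theorem isReducedWord_varpiWord {k : ℕ} (h₀ : 1 ≤ k) (hk : k ≤ r) :
    IsReducedWord relPerm (varpiWord r k) := by
  have ascending : ∀ p ≤ k, IsAscending 1 (List.replicate p (cycleWord r k)).flatten := by
    intro p hp
    induction p with
    | zero => exact trivial
    | succ p ih =>
      rw [List.replicate_succ', List.flatten_append, List.flatten_singleton, isAscending_append,
        one_mul, permProd_flatten_replicate]
      refine ⟨ih (by omega), isAscending_cycleWord h₀ hk (fun x hx₀ hx₁ => ?_)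
        fun x hx₀ hx₁ => ?_⟩
      · rw [permProd_cycleWord_pow_apply h₀ hk (by omega) hx₀ hx₁]
        split_ifs <;> omega
      · rw [permProd_cycleWord_pow_apply h₀ hk (by omega) (by omega) hx₁, if_neg (by omega),
          if_neg (by omega)]
  exact isReducedWord_of_isAscending (ascending k le_rfl)

end Ascending

/-! ### The elements `ϖ_k` -/

section Varpi

variable {r : ℕ}

theorem varpi_apply (i : Node r) (x : RootLattice r) :
    varpi r i x = x - (x i + x (-i) - 2 * x 0) • delta r := by
  have pairing : ∀ j y, (fundamentalWeight r j).1 y = y j - y 0 := fun _ _ => rfl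
  rw [varpi, LinearEquiv.mul_apply, translation_apply, translation_apply, map_sub, map_smul,
    pairing, pairing, pairing, delta_apply, delta_apply, tau]
  module

/-- The number of periods by which the permutation realizing `ϖ_k` moves `a`, for
`-r ≤ a ≤ r + 1`. -/
def varpiShift (k : ℕ) (a : ℤ) : ℤ :=
  if 1 ≤ a ∧ a ≤ k then 1 else if 1 - k ≤ a ∧ a ≤ 0 then -1 else 0

theorem varpi_simpleRoot {k : ℕ} (h₀ : 1 ≤ k) (hk : k ≤ r) {a : ℤ} (ha₀ : -r ≤ a) (ha₁ : a ≤ r) :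
    varpi r k (simpleRoot r a) =
      simpleRoot r a + (varpiShift k (a + 1) - varpiShift k a) • delta r := by
  have eq_k := intCast_node_inj (r := r) (x := k) (y := a) (by rw [abs_le]; omega)
  have eq_neg := intCast_node_inj (r := r) (x := -k) (y := a) (by rw [abs_le]; omega)
  have eq_zero := intCast_node_inj (r := r) (x := 0) (y := a) (by rw [abs_le]; omega)
  push_cast at eq_k eq_neg eq_zero
  rw [varpi_apply, sub_eq_add_neg, ← neg_smul]
  simp only [simpleRoot, Pi.single_apply, eq_k, eq_neg, eq_zero, varpiShift]
  congr 2
  split_ifs <;> omega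

theorem varpiShift_one_sub (k : ℕ) (a : ℤ) : varpiShift k (1 - a) = -varpiShift k a := by
  unfold varpiShift
  split_ifs <;> omega

theorem apply_eq_add_varpiShift {f : Equiv.Perm ℤ} (hf : f ∈ symmetricPerm r) {k : ℕ} (hk : k ≤ r)
    (h : ∀ x : ℤ, 1 ≤ x → x ≤ r → f x = if x ≤ k then x + (2 * r + 1) else x) {a : ℤ}
    (ha₀ : -r ≤ a) (ha₁ : a ≤ r + 1) : f a = a + varpiShift k a * (2 * r + 1) := by
  have pos : ∀ x : ℤ, 1 ≤ x → x ≤ r + 1 → f x = x + varpiShift k x * (2 * r + 1) := by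
    intro x hx₀ hx₁
    unfold varpiShift
    rcases hx₁.lt_or_eq with hlt | rfl
    · rw [h x hx₀ (by omega)]
      split_ifs <;> omega
    · rw [apply_center hf, if_neg (by omega), if_neg (by omega), zero_mul, add_zero]
  rcases lt_or_ge 0 a with hpos | hneg
  · exact pos a hpos ha₁
  · have reflect := (mem_symmetricPerm.1 hf).2 a
    rw [pos (1 - a) (by omega) (by omega), varpiShift_one_sub] at reflect
    linarith

theorem symmetricRep_eq_varpi {f : symmetricPerm r} {k : ℕ} (h₀ : 1 ≤ k) (hk : k ≤ r)
    (h : ∀ x : ℤ, 1 ≤ x → x ≤ r → f.1 x = if x ≤ k then x + (2 * r + 1) else x) :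
    symmetricRep r f = varpi r k := by
  refine permRep_eq_of_simpleRoot fun a ha₀ ha₁ => ?_
  change rootVec r (f.1 (a + 1)) - rootVec r (f.1 a) = _
  rw [apply_eq_add_varpiShift f.2 hk h ha₀ (by omega),
    apply_eq_add_varpiShift f.2 hk h (by omega) (by omega), rootVec_add_mul_period,
    rootVec_add_mul_period, varpi_simpleRoot h₀ hk ha₀ ha₁, rootVec_add_one]
  module

theorem symmetricRep_varpiWord [NeZero r] {k : ℕ} (h₀ : 1 ≤ k) (hk : k ≤ r) :
    symmetricRep r (permProd (varpiWord r k)) = varpi r k :=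
  symmetricRep_eq_varpi h₀ hk fun _ => permProd_varpiWord_apply h₀ hk

theorem symmetricRep_varpiPredWord [NeZero r] (hr : 2 ≤ r) :
    symmetricRep r (permProd (varpiPredWord r)) = varpi r (r - 1 : ℕ) :=
  symmetricRep_eq_varpi (by omega) (by omega) fun _ => permProd_varpiPredWord_apply hr

theorem isReducedWord_varpiPredWord [NeZero r] (hr : 2 ≤ r) :
    IsReducedWord relPerm (varpiPredWord r) := by
  have same_rep : symmetricRep r (permProd (varpiPredWord r)) =
      symmetricRep r (permProd (varpiWord r (r - 1))) := by
    rw [symmetricRep_varpiPredWord hr, symmetricRep_varpiWord (by omega) (by omega)]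
  exact (isReducedWord_varpiWord (by omega) (by omega)).of_length_le
    (symmetricRep_injective r same_rep) (length_varpiPredWord hr).le

theorem varpi_mul_tauLattice_comm (i : Node r) :
    varpi r i * tauLattice r = tauLattice r * varpi r i := by
  have tauLattice_apply : ∀ x j, tauLattice r x j = x (-j) := fun _ _ => rfl
  have tauLattice_delta : tauLattice r (delta r) = delta r := by
    ext j
    rw [tauLattice_apply, delta_apply, delta_apply]
  ext1 x
  rw [LinearEquiv.mul_apply, LinearEquiv.mul_apply, varpi_apply, varpi_apply, map_sub, map_smul,
    tauLattice_delta, tauLattice_apply, tauLattice_apply, tauLattice_apply, neg_neg, neg_zero,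
    add_comm (x (-i))]

theorem varpi_mem_relativeWeylGroup [NeZero r] {k : ℕ} (h₀ : 1 ≤ k) (hk : k ≤ r) :
    varpi r k ∈ relativeWeylGroup r := by
  refine Subgroup.mem_inf.2 ⟨?_, ?_⟩
  · rw [← symmetricRep_varpiWord h₀ hk, permProd, ← prod_map_relReflection]
    refine Subgroup.list_prod_mem _ fun x hx => ?_
    obtain ⟨i, -, rfl⟩ := List.mem_map.1 hx
    exact relReflection_mem_affineWeylGroup _
  · exact Subgroup.mem_centralizer_singleton_iff.2 (varpi_mul_tauLattice_comm _)

end Varpi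

/-! ### Lifts -/

section Lift

variable {r : ℕ} {G : Type*} [Group G] {T : Fin (r + 1) → G}

/-- The family `T` satisfies the defining relations of the ibraid group. -/
def SatisfiesBraidRelations (r : ℕ) {G : Type*} [Group G] (T : Fin (r + 1) → G) : Prop :=
  ∀ i j : Fin (r + 1),
    altProd (T i) (T j) (orderOf (relReflection r (rep r i) * relReflection r (rep r j))) =
      altProd (T j) (T i) (orderOf (relReflection r (rep r i) * relReflection r (rep r j)))

theorem satisfiesBraidRelations_braidGen (r : ℕ) : SatisfiesBraidRelations r (braidGen r) := by
  intro i j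
  have relation := PresentedGroup.one_of_mem (rels := braidRelations r) ⟨i, j, _, rfl, rfl⟩
  rwa [map_mul, map_inv, mul_inv_eq_one, map_altProd, map_altProd] at relation

theorem SatisfiesBraidRelations.map {H : Type*} [Group H] (hT : SatisfiesBraidRelations r T)
    (φ : G →* H) : SatisfiesBraidRelations r fun i => φ (T i) := fun i j => by
  rw [← map_altProd, ← map_altProd, hT i j]

theorem prod_map_cycleWord (T : Fin (r + 1) → G) (k : ℕ) :
    ((cycleWord r k).map T).prod = prodUp T 0 r * prodDown T (r - 1) k := by
  rw [cycleWord, List.map_append, List.prod_append]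
  rfl

variable [NeZero r]

theorem isReducedExpr_iff {l : List (Fin (r + 1))} {w : RootLattice r ≃ₗ[ℤ] RootLattice r} :
    IsReducedExpr r l w ↔ symmetricRep r (permProd l) = w ∧ IsReducedWord relPerm l := by
  unfold IsReducedExpr IsReducedWord permProd
  simp only [prod_map_relReflection]
  refine and_congr_right fun h => ?_
  simp only [← h, (symmetricRep_injective r).eq_iff]

theorem SatisfiesBraidRelations.isLift (hT : SatisfiesBraidRelations r T) {l : List (Fin (r + 1))}
    (hl : IsReducedWord relPerm l) {w : RootLattice r ≃ₗ[ℤ] RootLattice r}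
    (hw : symmetricRep r (permProd l) = w) : IsLift r T w (l.map T).prod := by
  refine ⟨⟨l, isReducedExpr_iff.2 ⟨hw, hl⟩⟩, fun l' hl' => ?_⟩
  obtain ⟨hw', hl'⟩ := isReducedExpr_iff.1 hl'
  refine isSignSystem_relPerm.prod_map_eq_of_isReducedWord (fun i j => ?_) hl hl'
    (symmetricRep_injective r (hw.trans hw'.symm))
  rw [← orderOf_relReflection_mul]
  exact hT i j

theorem SatisfiesBraidRelations.isLift_varpi (hT : SatisfiesBraidRelations r T) {k : ℕ}
    (h₀ : 1 ≤ k) (hk : k ≤ r) :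
    IsLift r T (varpi r k) ((prodUp T 0 r * prodDown T (r - 1) k) ^ k) := by
  rw [← prod_map_cycleWord, ← prod_map_flatten_replicate]
  exact hT.isLift (isReducedWord_varpiWord h₀ hk) (symmetricRep_varpiWord h₀ hk)

theorem SatisfiesBraidRelations.isLift_varpi_last (hT : SatisfiesBraidRelations r T) :
    IsLift r T (varpi r r) (prodUp T 0 r ^ r) := by
  have h := hT.isLift_varpi (NeZero.pos r) le_rfl
  rwa [← prod_map_cycleWord, cycleWord_self (NeZero.pos r)] at h

theorem SatisfiesBraidRelations.isLift_varpi_pred (hT : SatisfiesBraidRelations r T) (hr : 2 ≤ r) :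
    IsLift r T (varpi r (r - 1 : ℕ)) (prodUp T 0 r ^ (r - 1) * prodUp T 1 (r - 1)) := by
  have h := hT.isLift (isReducedWord_varpiPredWord hr) (symmetricRep_varpiPredWord hr)
  rwa [varpiPredWord, List.map_append, List.prod_append, prod_map_flatten_replicate,
    cycleWord_self (NeZero.pos r)] at h

end Lift

theorem proposition2p6_general (r : ℕ) (hr : 1 ≤ r) :
    (∀ k : ℕ, 1 ≤ k → k ≤ r → varpi r (k : Node r) ∈ relativeWeylGroup r) ∧
    ∀ {G : Type*} [Group G] {T : Fin (r + 1) → G}, SatisfiesBraidRelations r T →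
      (∀ k : ℕ, 1 ≤ k → k ≤ r →
        IsLift r T (varpi r (k : Node r)) ((prodUp T 0 r * prodDown T (r - 1) k) ^ k)) ∧
      IsLift r T (varpi r ((1 : ℕ) : Node r)) (prodUp T 0 r * prodDown T (r - 1) 1) ∧
      (2 ≤ r → IsLift r T (varpi r ((r - 1 : ℕ) : Node r))
        (prodUp T 0 r ^ (r - 1) * prodUp T 1 (r - 1))) ∧
      IsLift r T (varpi r (r : Node r)) (prodUp T 0 r ^ r) := by
  have : NeZero r := ⟨by omega⟩
  refine ⟨fun _ => varpi_mem_relativeWeylGroup, fun hT => ⟨fun _ => hT.isLift_varpi, ?_,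
    hT.isLift_varpi_pred, hT.isLift_varpi_last⟩⟩
  simpa only [pow_one] using hT.isLift_varpi le_rfl hr

end IBraid

open IBraid in
/-- For `1 ≤ k ≤ r`, `T_{ϖ_k} = (T_0 T_1 ⋯ T_{r-1} T_r T_{r-1} ⋯ T_k)^k`, together with the special
forms for `k = 1, r - 1, r`, in the ibraid group itself and for the automorphisms `𝐓_i` by
which it acts on the iquantum group. -/
theorem proposition2p6 (r : ℕ) (hr : 1 ≤ r) :
    (∀ k : ℕ, 1 ≤ k → k ≤ r → varpi r (k : Node r) ∈ relativeWeylGroup r) ∧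
    -- in the ibraid group
    ((∀ k : ℕ, 1 ≤ k → k ≤ r →
        IsLift r (braidGen r) (varpi r (k : Node r))
          ((prodUp (braidGen r) 0 r * prodDown (braidGen r) (r - 1) k) ^ k)) ∧
      IsLift r (braidGen r) (varpi r ((1 : ℕ) : Node r))
        (prodUp (braidGen r) 0 r * prodDown (braidGen r) (r - 1) 1) ∧
      (2 ≤ r → IsLift r (braidGen r) (varpi r ((r - 1 : ℕ) : Node r))
        (prodUp (braidGen r) 0 r ^ (r - 1) * prodUp (braidGen r) 1 (r - 1))) ∧
      IsLift r (braidGen r) (varpi r (r : Node r)) (prodUp (braidGen r) 0 r ^ r)) ∧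
    -- for the automorphisms of the iquantum group
    (∀ Φ : IBraidGroup r →* (IQuantumGroup r ≃ₐ[Scalar] IQuantumGroup r), IsIBraidAction r Φ →
      ∀ T : Fin (r + 1) → (IQuantumGroup r ≃ₐ[Scalar] IQuantumGroup r),
        (∀ i, T i = Φ (braidGen r i)) →
      (∀ k : ℕ, 1 ≤ k → k ≤ r →
        IsLift r T (varpi r (k : Node r)) ((prodUp T 0 r * prodDown T (r - 1) k) ^ k)) ∧
      IsLift r T (varpi r ((1 : ℕ) : Node r)) (prodUp T 0 r * prodDown T (r - 1) 1) ∧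
      (2 ≤ r → IsLift r T (varpi r ((r - 1 : ℕ) : Node r))
        (prodUp T 0 r ^ (r - 1) * prodUp T 1 (r - 1))) ∧
      IsLift r T (varpi r (r : Node r)) (prodUp T 0 r ^ r)) := by
  obtain ⟨mem, lift⟩ := proposition2p6_general r hr
  refine ⟨mem, lift (satisfiesBraidRelations_braidGen r), fun Φ _ T hT => ?_⟩
  obtain rfl : T = fun i => Φ (braidGen r i) := funext hT
  exact lift ((satisfiesBraidRelations_braidGen r).map Φ)
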